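/- Write $\mathcal C_n$ for the cyclic group of order $n$, and let $$\Phi(1)=\{\mathcal C_n \mid n=1,\dots,10,12\}\cup\{\mathcal C_2\times\mathcal C_{2m}\mid m=1,\dots,4\},$$ which by Mazur's theorem is the set of groups that occur, up to isomorphism, as the torsion subgroup $E(\mathbb Q)_{\mathrm{tors}}$ of an elliptic curve $E$ over $\mathbb Q$. Let $G\in\Phi(1)$ be a group that is not cyclic of even order. Then there exists an elliptic curve $E$ defined over $\mathbb Q$ such that $E(\mathbb Q)_{\mathrm{tors}}\cong G$ and, for every quadratic extension $K/\mathbb Q$, $E(K)_{\mathrm{tors}}=E(\mathbb Q)_{\mathrm{tors}}$ (that is, every torsion point of $E(K)$ already lies in $E(\mathbb Q)$). -/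

import Mathlib

/-- The subgroup `E(K)_tors` of points of finite order in the Mordell-Weil group `E(K)`,
for a Weierstrass curve `E` over `ℚ` and a field `K` of characteristic zero. -/
noncomputable def torsionPoints (E : WeierstrassCurve ℚ) (K : Type*) [Field K] [DecidableEq K]
    [Algebra ℚ K] :
    AddSubgroup (E.baseChange K).toAffine.Point :=
  AddCommGroup.torsion (E.baseChange K).toAffine.Point

/-- The inclusion `E(ℚ) → E(K)` of groups of rational points. -/
noncomputable def pointInclusion (E : WeierstrassCurve ℚ) (K : Type*) [Field K] [DecidableEq K]
    [Algebra ℚ K] :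
    (E.baseChange ℚ).toAffine.Point →+ (E.baseChange K).toAffine.Point :=
  WeierstrassCurve.Affine.Point.baseChange (W' := E.toAffine) ℚ K

/-- `G` is (isomorphic to) one of the fifteen groups in
`Φ(1) = {C_n | n = 1, …, 10, 12} ∪ {C_2 × C_{2m} | m = 1, …, 4}`. -/
def MemPhiOne (G : Type*) [AddCommGroup G] : Prop :=
  (∃ n : ℕ, ((1 ≤ n ∧ n ≤ 10) ∨ n = 12) ∧ Nonempty (G ≃+ ZMod n)) ∨
  (∃ m : ℕ, (1 ≤ m ∧ m ≤ 4) ∧ Nonempty (G ≃+ ZMod 2 × ZMod (2 * m)))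

/-- `G` is cyclic of even order, that is, isomorphic to `C_{2n}` for some `n ≥ 1`. -/
def IsEvenCyclic (G : Type*) [AddCommGroup G] : Prop :=
  ∃ n : ℕ, 1 ≤ n ∧ Nonempty (G ≃+ ZMod (2 * n))

/-! Each of the nine groups is realized by an explicit model y² = x³ + a x² + b x + c over ℤ with an
explicit finite group R of rational points. The work is to bound the torsion over every quadratic
field K by R; since E(ℚ) embeds in E(K), this also determines the rational torsion.

Let σ be the conjugation of K. If P has odd order, σ negates P - σP, so that point has rational
abscissa. If all odd-order points with rational abscissa lie in R, then σ also fixes P - σP, which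
is therefore zero, and P itself has rational abscissa. Thus (`torsionPoints_le`) two things are
needed: odd-order points with rational abscissa lie in R (they come from E and all its quadratic
twists at once), and R is closed under halving.

Halving. In the odd cyclic case the cubic has no rational root, which excludes 2-torsion over K, and
R = 2R. With full 2-torsion e₁, e₂, e₃, a double (x, y) has every x - eᵢ a square in K; a quadratic
field cannot make r and s squares when r, s and rs are nonsquare integers, and this is checked on
representatives of R/2R.

Odd order. Take an odd prime p of good reduction and a valuation ring of K above it. A formal group
argument phrased with abscissas (`abscissa_mem`) shows that points of odd order prime to p have
integral abscissa, so reduction of abscissas is injective up to sign and respects duplication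
(`exists_reduction`). Repeated doubling yields an infinite orbit of duplication in `ZMod p`, which
can never meet a root of the cubic. A finite check for a well-chosen p shows that orbits die, become
stationary (forcing 3P = 0), or hit the abscissa of a known point (`mem_of_reduction`). Points of
order p are excluded beforehand: by the 3-division polynomial for p = 3, by duplication cycles
modulo a second prime for p > 3. -/

open WeierstrassCurve WeierstrassCurve.Affine

/-! ### The group law in terms of abscissas -/

/-- `V` is the Weierstrass curve `y² = x³ + a x² + b x + c`. -/
structure IsCubicModel {F : Type*} [Field F] (V : WeierstrassCurve.Affine F) (a b c : F) :
    Prop where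
  a₁ : V.a₁ = 0
  a₂ : V.a₂ = a
  a₃ : V.a₃ = 0
  a₄ : V.a₄ = b
  a₆ : V.a₆ = c

/-- The abscissa of a point, with value `0` at the point at infinity. -/
def WeierstrassCurve.Affine.Point.abscissa {F : Type*} [Field F] {V : WeierstrassCurve.Affine F} :
    V.Point → F
  | .zero => 0
  | .some x _ _ => x

namespace IsCubicModel

variable {F : Type*} [Field F] {V : WeierstrassCurve.Affine F} {a b c : F}

theorem equation_iff (hV : IsCubicModel V a b c) (x y : F) :
    V.Equation x y ↔ y ^ 2 = x ^ 3 + a * x ^ 2 + b * x + c := by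
  rw [Affine.equation_iff, hV.a₁, hV.a₂, hV.a₃, hV.a₄, hV.a₆]
  simp

theorem negY_eq (hV : IsCubicModel V a b c) (x y : F) : V.negY x y = -y := by
  simp [Affine.negY, hV.a₁, hV.a₃]

theorem neg_some (hV : IsCubicModel V a b c) {x y : F} (h : V.Nonsingular x y)
    (h' : V.Nonsingular x (-y)) : -Point.some x y h = Point.some x (-y) h' := by
  rw [Point.neg_some]
  simp only [hV.negY_eq]

theorem abscissa_neg (P : V.Point) : (-P).abscissa = P.abscissa := by
  cases P <;> rfl

theorem eq_or_eq_neg {P Q : V.Point} (hP : P ≠ 0) (hQ : Q ≠ 0) (h : P.abscissa = Q.abscissa) :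
    P = Q ∨ P = -Q := by
  cases P with
  | zero => exact absurd rfl hP
  | some x y hxy =>
    cases Q with
    | zero => exact absurd rfl hQ
    | some x' y' hxy' => exact Point.X_eq_iff.mp h

variable [DecidableEq F]

theorem add_self_some (hV : IsCubicModel V a b c) {x y : F} {h : V.Nonsingular x y}
    {x' y' : F} (h' : V.Nonsingular x' y') (hy : 2 * y ≠ 0) (l : F)
    (hl : l * (2 * y) = 3 * x ^ 2 + 2 * a * x + b) (hx' : x' = l ^ 2 - a - 2 * x)
    (hy' : y' = -(l * (x' - x) + y)) :
    Point.some x y h + Point.some x y h = Point.some x' y' h' := by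
  have hn : y ≠ V.negY x y := by
    rw [hV.negY_eq]
    intro H
    exact hy (by linear_combination H)
  have hs : V.slope x x y y = l := by
    rw [Affine.slope_of_Y_ne rfl hn, hV.negY_eq, hV.a₁, hV.a₂, hV.a₄]
    rw [div_eq_iff (by rwa [sub_neg_eq_add, ← two_mul])]
    linear_combination -hl
  have hX : V.addX x x l = x' := by
    rw [Affine.addX, hV.a₁, hV.a₂, hx']
    ring
  rw [Point.add_self_of_Y_ne hn]
  simp only [Point.some.injEq, Affine.addY, Affine.negAddY, hs, hX, hV.negY_eq, true_and]
  exact hy'.symm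

theorem add_some_some (hV : IsCubicModel V a b c) {x₁ y₁ x₂ y₂ : F} {h₁ : V.Nonsingular x₁ y₁}
    {h₂ : V.Nonsingular x₂ y₂} {x' y' : F} (h' : V.Nonsingular x' y') (hx : x₁ ≠ x₂) (l : F)
    (hl : l * (x₁ - x₂) = y₁ - y₂) (hx' : x' = l ^ 2 - a - x₁ - x₂)
    (hy' : y' = -(l * (x' - x₁) + y₁)) :
    Point.some x₁ y₁ h₁ + Point.some x₂ y₂ h₂ = Point.some x' y' h' := by
  have hs : V.slope x₁ x₂ y₁ y₂ = l := by
    rw [Affine.slope_of_X_ne hx, div_eq_iff (sub_ne_zero.mpr hx)]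
    exact hl.symm
  have hX : V.addX x₁ x₂ l = x' := by
    rw [Affine.addX, hV.a₁, hV.a₂, hx']
    ring
  rw [Point.add_of_X_ne hx]
  simp only [Point.some.injEq, Affine.addY, Affine.negAddY, hs, hX, hV.negY_eq, true_and]
  exact hy'.symm

theorem add_self_eq_zero_iff (hV : IsCubicModel V a b c) {x y : F} (h : V.Nonsingular x y) :
    Point.some x y h + Point.some x y h = 0 ↔ 2 * y = 0 := by
  constructor
  · intro H
    by_contra hy
    have hn : y ≠ V.negY x y := by
      rw [hV.negY_eq]
      intro H
      exact hy (by linear_combination H)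
    rw [Point.add_self_of_Y_ne hn] at H
    exact Point.some_ne_zero _ H
  · intro H
    refine Point.add_self_of_Y_eq ?_
    rw [hV.negY_eq]
    linear_combination H

theorem add_self_eq (hV : IsCubicModel V a b c) {x y : F} (h : V.Nonsingular x y)
    (h0 : 2 * y ≠ 0) : ∃ l x' y' h', l * (2 * y) = 3 * x ^ 2 + 2 * a * x + b ∧
      x' = l ^ 2 - a - 2 * x ∧ Point.some x y h + Point.some x y h = Point.some x' y' h' := by
  have hn : y ≠ V.negY x y := by
    rw [hV.negY_eq]
    intro H
    exact h0 (by linear_combination H)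
  refine ⟨V.slope x x y y, _, _, _, ?_, ?_, Point.add_self_of_Y_ne hn⟩
  · rw [Affine.slope_of_Y_ne rfl hn, hV.negY_eq, hV.a₁, hV.a₂, hV.a₄]
    have : y - -y ≠ 0 := by rwa [sub_neg_eq_add, ← two_mul]
    rw [div_mul_eq_mul_div, div_eq_iff this]
    ring
  · rw [Affine.addX, hV.a₁, hV.a₂]
    ring

/-- The duplication formula for abscissas. -/
theorem abscissa_add_self (hV : IsCubicModel V a b c) {P : V.Point} (hP : P ≠ 0)
    (h2 : P + P ≠ 0) :
    let x := P.abscissa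
    4 * (x ^ 3 + a * x ^ 2 + b * x + c) ≠ 0 ∧
    (P + P).abscissa * (4 * (x ^ 3 + a * x ^ 2 + b * x + c)) =
      x ^ 4 - 2 * b * x ^ 2 - 8 * c * x + b ^ 2 - 4 * a * c := by
  cases P with
  | zero => exact absurd rfl hP
  | some x y h =>
    have hy : 2 * y ≠ 0 := fun H ↦ h2 ((hV.add_self_eq_zero_iff h).mpr H)
    have he := (hV.equation_iff x y).mp h.1
    obtain ⟨l, x', y', h', hl, hx', hadd⟩ := hV.add_self_eq h hy
    rw [hadd]
    simp only [Point.abscissa]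
    have h4 : 4 * (x ^ 3 + a * x ^ 2 + b * x + c) = (2 * y) ^ 2 := by rw [← he]; ring
    refine ⟨by rw [h4]; exact pow_ne_zero 2 hy, ?_⟩
    rw [h4, hx']
    linear_combination (l * (2 * y) + (3 * x ^ 2 + 2 * a * x + b)) * hl
      - 4 * (a + 2 * x) * he

/-- The sum and product of the abscissas of `P + Q` and `P - Q`. -/
theorem abscissa_add_sub (hV : IsCubicModel V a b c) {P Q : V.Point} (hP : P ≠ 0) (hQ : Q ≠ 0)
    (h1 : P + Q ≠ 0) (h2 : P - Q ≠ 0) :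
    let x := P.abscissa
    let z := Q.abscissa
    x ≠ z ∧
    ((P + Q).abscissa + (P - Q).abscissa) * (x - z) ^ 2 =
      2 * (x * z * (x + z) + 2 * a * (x * z) + b * (x + z) + 2 * c) ∧
    (P + Q).abscissa * (P - Q).abscissa * (x - z) ^ 2 =
      (x * z - b) ^ 2 - 4 * c * (x + z + a) := by
  cases P with
  | zero => exact absurd rfl hP
  | some x y h =>
    cases Q with
    | zero => exact absurd rfl hQ
    | some z w k =>
      have hxz : x ≠ z := by
        intro H
        rcases Point.X_eq_iff.mp H with H | H
        · exact h2 (by rw [H, sub_self])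
        · exact h1 (by rw [H, neg_add_cancel])
      have he := (hV.equation_iff x y).mp h.1
      have ke := (hV.equation_iff z w).mp k.1
      have k' : V.Nonsingular z (-w) := by
        have := (Affine.nonsingular_neg z w).mpr k
        rwa [hV.negY_eq] at this
      rw [sub_eq_add_neg, hV.neg_some k k', Point.add_of_X_ne hxz, Point.add_of_X_ne hxz]
      simp only [Point.abscissa, Affine.addX, Affine.slope_of_X_ne hxz, hV.a₁, hV.a₂]
      have hd : x - z ≠ 0 := sub_ne_zero.mpr hxz
      refine ⟨hxz, ?_, ?_⟩
      · field_simp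
        linear_combination 2 * he + 2 * ke
      · field_simp
        -- The product and the sum of (y - w)² and (y + w)² are polynomials in y² and w², so the
        -- ordinates can be eliminated.
        have e1 : (y - w) ^ 2 * (y + w) ^ 2 = (x ^ 3 + a * x ^ 2 + b * x + c -
          (z ^ 3 + a * z ^ 2 + b * z + c)) ^ 2 := by
          rw [← he, ← ke]; ring
        have e2 : (y - w) ^ 2 + (y + w) ^ 2 = 2 * (x ^ 3 + a * x ^ 2 + b * x + c +
          (z ^ 3 + a * z ^ 2 + b * z + c)) := by
          rw [← he, ← ke]; ring
        linear_combination e1 - (x - z) ^ 2 * (a + x + z) * e2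

/-- If `P + P = (x, y)` on `y² = (x - e₁) (x - e₂) (x - e₃)` then `x - e₁` is a square. -/
theorem isSquare_of_add_self (hV : IsCubicModel V a b c) {e₁ e₂ e₃ : F} (ha : a = -(e₁ + e₂ + e₃))
    (hb : b = e₁ * e₂ + e₁ * e₃ + e₂ * e₃) (hc : c = -(e₁ * e₂ * e₃)) {P : V.Point} (hP : P ≠ 0)
    (h2 : P + P ≠ 0) : IsSquare ((P + P).abscissa - e₁) := by
  obtain ⟨h4, hx⟩ := hV.abscissa_add_self hP h2
  cases P with
  | zero => exact absurd rfl hP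
  | some x y h =>
    have hy : 2 * y ≠ 0 := fun H ↦ h2 ((hV.add_self_eq_zero_iff h).mpr H)
    have he := (hV.equation_iff x y).mp h.1
    -- The numerator is (x - e₁)² - (e₁ - e₂)(e₁ - e₃).
    refine ⟨(x ^ 2 - 2 * e₁ * x + (e₁ * e₂ + e₁ * e₃ - e₂ * e₃)) / (2 * y), ?_⟩
    rw [div_mul_div_comm, eq_div_iff (mul_ne_zero hy hy)]
    simp only [Point.abscissa] at hx ⊢
    have h4' : 2 * y * (2 * y) = 4 * (x ^ 3 + a * x ^ 2 + b * x + c) := by rw [← he]; ring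
    rw [h4', sub_mul]
    rw [hx, ha, hb, hc]
    ring

end IsCubicModel

/-! ### Integrality and reduction at a valuation ring -/

namespace IsCubicModel

variable {K : Type*} [Field K] {A : ValuationSubring K} {a b c : A}
  {V : WeierstrassCurve.Affine K}

theorem coe_two (A : ValuationSubring K) : ((2 : A) : K) = 2 :=
  map_ofNat A.subtype 2

theorem coe_four (A : ValuationSubring K) : ((4 : A) : K) = 4 :=
  map_ofNat A.subtype 4

theorem coe_eight (A : ValuationSubring K) : ((8 : A) : K) = 8 :=
  map_ofNat A.subtype 8

theorem exists_mul_eq_one_of_mem {t : A} (ht : t ∈ IsLocalRing.maximalIdeal A) (w : A) :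
    ∃ d, (1 + t * w) * d = 1 := by
  refine (IsUnit.exists_right_inv ?_)
  by_contra h
  have h1 : 1 + t * w ∈ IsLocalRing.maximalIdeal A := h
  have h2 : t * w ∈ IsLocalRing.maximalIdeal A := Ideal.mul_mem_right _ _ ht
  have h3 := Ideal.sub_mem _ h1 h2
  rw [add_sub_cancel_right] at h3
  exact (Ideal.ne_top_iff_one _).mp (IsLocalRing.maximalIdeal.isMaximal A).ne_top h3

variable [DecidableEq K]

/-- Near the point at infinity, the inverse `t` of the abscissa satisfies `t (2 P) ≡ 4 t (P)`
modulo `t (P) ^ 2`. -/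
theorem exists_inv_abscissa_add_self (hV : IsCubicModel V (a : K) b c) {P : V.Point} (hP : P ≠ 0)
    (h2 : P + P ≠ 0) {t : A} (ht : t ∈ IsLocalRing.maximalIdeal A) (hx : P.abscissa * t = 1) :
    ∃ u : A, (P + P).abscissa * ((4 * t + t ^ 2 * u : A) : K) = 1 := by
  obtain ⟨-, h⟩ := hV.abscissa_add_self hP h2
  set x := P.abscissa
  set x' := (P + P).abscissa
  -- `d` inverts the numerator of the duplication formula multiplied by t⁴, which is 1 modulo t.
  obtain ⟨d, hd⟩ := exists_mul_eq_one_of_mem ht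
    (-2 * b * t - 8 * c * t ^ 2 + (b ^ 2 - 4 * a * c) * t ^ 3)
  refine ⟨4 * (a + b * t + c * t ^ 2) * d
    - 4 * d * (-2 * b * t - 8 * c * t ^ 2 + (b ^ 2 - 4 * a * c) * t ^ 3), ?_⟩
  have hs : 4 * t + t ^ 2 * (4 * (a + b * t + c * t ^ 2) * d
    - 4 * d * (-2 * b * t - 8 * c * t ^ 2 + (b ^ 2 - 4 * a * c) * t ^ 3)) =
      4 * t * (1 + a * t + b * t ^ 2 + c * t ^ 3) * d := by
    linear_combination -4 * t * hd
  rw [hs]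
  have hd' := congrArg (Subtype.val : A → K) hd
  push_cast at hd' ⊢
  simp only [coe_two, coe_four, coe_eight] at hd' ⊢
  have key : x' * (4 * (t : K) * (1 + a * t + b * t ^ 2 + c * t ^ 3)) =
      1 - 2 * b * t ^ 2 - 8 * c * t ^ 3 + (b ^ 2 - 4 * a * c) * t ^ 4 := by
    have e : ∀ k : ℕ, x ^ k * (t : K) ^ k = 1 := fun k ↦ by rw [← mul_pow, hx, one_pow]
    have e4 := e 4
    have e3 := e 3
    have e2 := e 2
    have e1 := e 1
    linear_combination (t : K) ^ 4 * h - x' * 4 * (t * e3 + a * t ^ 2 * e2 + b * t ^ 3 * e1) + e4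
      - 2 * b * t ^ 2 * e2 - 8 * c * t ^ 3 * e1
  linear_combination d * key + hd'

/-- Near the point at infinity, the inverse `t` of the abscissa satisfies
`t (Q + P) + t (Q - P) ≡ 2 t (Q) + 2 t (P)` modulo `t (P) ^ 2`. -/
theorem exists_inv_abscissa_add (hV : IsCubicModel V (a : K) b c) {P Q : V.Point} (hP : P ≠ 0)
    (hQ : Q ≠ 0) (h1 : Q + P ≠ 0) (h2 : Q - P ≠ 0) {t : A}
    (ht : t ∈ IsLocalRing.maximalIdeal A) (hx : P.abscissa * t = 1) {s s' q : A}
    (hs : s = t * q) (hxs : Q.abscissa * s = 1) (hs' : (Q - P).abscissa * s' = 1) :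
    ∃ u : A, (Q + P).abscissa * ((2 * t + 2 * s - s' + t ^ 2 * u : A) : K) = 1 := by
  obtain ⟨-, hS, hM⟩ := hV.abscissa_add_sub hQ hP h1 h2
  set x := Q.abscissa
  set z := P.abscissa
  set X := (Q + P).abscissa
  set Y := (Q - P).abscissa
  -- With X, Y the abscissas of Q ± P, the formulas become X + Y = n / (t - s)² and XY = (1 + tw) /
  -- (t - s)². Hence 1/X + 1/Y = nd. The hypothesis s = tq makes all error terms multiples of t².
  set w : A := q * t * (-2 * b + b ^ 2 * s * t - 4 * c * (s + t + a * s * t)) with hw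
  obtain ⟨d, hd⟩ := exists_mul_eq_one_of_mem ht w
  set n : A := 2 * ((t + s) + 2 * a * (s * t) + b * (s * t) * (s + t) + 2 * c * (s * t) ^ 2) with hn
  refine ⟨2 * (2 * a * q + b * q * (s + t) + 2 * c * q * (s * t)) -
    2 * (1 + q + t * (2 * a * q + b * q * (s + t) + 2 * c * q * (s * t))) * w * d, ?_⟩
  have e : 2 * t + 2 * s - s' + t ^ 2 * (2 * (2 * a * q + b * q * (s + t) + 2 * c * q * (s * t)) -
    2 * (1 + q + t * (2 * a * q + b * q * (s + t) + 2 * c * q * (s * t))) * w * d) =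
      n * d - s' := by
    have e1 : n = 2 * (t + t * q + t ^ 2 * (2 * a * q + b * q * (s + t) + 2 * c * q * (s * t))) := by
      rw [hn]
      linear_combination (2 * (2 * a * t + b * t * (s + t) + 2 * c * s * t ^ 2) + 2) * hs
    rw [e1]
    linear_combination 2 * hs -
      2 * t * (1 + q + t * (2 * a * q + b * q * (s + t) + 2 * c * q * (s * t))) * hd
  rw [e]
  have hd' := congrArg (Subtype.val : A → K) hd
  have hn' := congrArg (Subtype.val : A → K) hn
  have hw' := congrArg (Subtype.val : A → K) hw
  have hs'' := congrArg (Subtype.val : A → K) hs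
  push_cast at hd' hn' hw' hs'' ⊢
  simp only [coe_two, coe_four] at hd' hn' hw' hs'' ⊢
  have kS : (X + Y) * ((t : K) - s) ^ 2 = n := by
    have e1 : ((t : K) - s) ^ 2 = (x - z) ^ 2 * (s * t) ^ 2 := by
      have : (t : K) - s = (x - z) * (s * t) := by linear_combination -(t : K) * hxs + s * hx
      rw [this]; ring
    rw [e1, ← mul_assoc, hS, hn']
    have p1 : x * z * ((s : K) * t) = 1 := by linear_combination z * t * hxs + hx
    have p2 : (x + z) * ((s : K) * t) = s + t := by linear_combination (t : K) * hxs + s * hx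
    linear_combination (2 * (x + z) * (s * t) + 4 * a * (s * t)) * p1
      + (2 + 2 * b * (s * t)) * p2
  have kM : X * Y * ((t : K) - s) ^ 2 = 1 + t * w := by
    have e1 : ((t : K) - s) ^ 2 = (x - z) ^ 2 * (s * t) ^ 2 := by
      have : (t : K) - s = (x - z) * (s * t) := by linear_combination -(t : K) * hxs + s * hx
      rw [this]; ring
    rw [e1, ← mul_assoc, hM, hw']
    have p1 : x * z * ((s : K) * t) = 1 := by linear_combination z * t * hxs + hx
    have p2 : (x + z) * ((s : K) * t) = s + t := by linear_combination (t : K) * hxs + s * hx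
    have p3 : (x * z - b) ^ 2 * ((s : K) * t) ^ 2 = (1 - b * (s * t)) ^ 2 := by
      rw [← p1]; ring
    linear_combination p3 - 4 * c * (s * t) * p2 + (t : K) * (-2 * b + b ^ 2 * s * t -
      4 * c * (s + t + a * s * t)) * hs''
  linear_combination -X * d * kS + (1 + X * s') * (d * kM + hd') - X ^ 2 * (t - s) ^ 2 * d * hs'

/-- A point of odd order `n` has integral abscissa with respect to every valuation ring in which
`n` is invertible. -/
theorem abscissa_mem (hV : IsCubicModel V (a : K) b c) {P : V.Point} {n : ℕ} (hn : Odd n)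
    (hP : n • P = 0) (hu : IsUnit (n : A)) : P.abscissa ∈ A := by
  by_contra hx
  have hP0 : P ≠ 0 := by
    rintro rfl
    exact hx A.zero_mem
  have hx0 : P.abscissa ≠ 0 := fun h ↦ hx (h ▸ A.zero_mem)
  set t : A := ⟨P.abscissa⁻¹, (A.mem_or_inv_mem _).resolve_left hx⟩ with ht
  have hxt : P.abscissa * (t : K) = 1 := mul_inv_cancel₀ hx0
  have htm : t ∈ IsLocalRing.maximalIdeal A := by
    intro hunit
    obtain ⟨d, hd⟩ := hunit.exists_right_inv
    have hd' := congrArg (Subtype.val : A → K) hd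
    push_cast at hd'
    have : P.abscissa = d := by linear_combination (d : K) * hxt - P.abscissa * hd'
    exact hx (this ▸ d.2)
  set N := addOrderOf P with hN
  have hdvd : N ∣ n := addOrderOf_dvd_of_nsmul_eq_zero hP
  have hNu : IsUnit (N : A) := isUnit_of_dvd_unit (Nat.cast_dvd_cast hdvd) hu
  obtain ⟨k, hk⟩ := hn.of_dvd_nat hdvd
  have hk0 : k ≠ 0 := by
    rintro rfl
    exact hP0 (AddMonoid.addOrderOf_eq_one_iff.mp hk)
  have hne : ∀ m, 0 < m → m < N → m • P ≠ 0 := fun m h0 h1 h2 ↦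
    absurd (Nat.le_of_dvd h0 (addOrderOf_dvd_of_nsmul_eq_zero h2)) (not_le.mpr h1)
  -- The inverse abscissa of jP is j² t modulo t², for 0 < j < N, where no multiple of P vanishes.
  have key : ∀ m : ℕ, m + 1 < N → ∃ u : A,
      ((m + 1) • P).abscissa * (((m + 1 : ℕ) ^ 2 * t + t ^ 2 * u : A) : K) = 1 := by
    intro m
    induction m using Nat.twoStepInduction with
    | zero => exact fun _ ↦ ⟨0, by simpa using hxt⟩
    | one =>
      intro h
      obtain ⟨u, hu⟩ := hV.exists_inv_abscissa_add_self hP0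
        (by rw [← two_nsmul]; exact hne 2 two_pos h) htm hxt
      refine ⟨u, ?_⟩
      rw [show (1 + 1) • P = P + P from two_nsmul P,
        show (((1 + 1 : ℕ) : A) ^ 2 * t + t ^ 2 * u : A) = 4 * t + t ^ 2 * u by push_cast; ring]
      exact hu
    | more m ih1 ih2 =>
      intro h
      obtain ⟨u', hu'⟩ := ih1 (by omega)
      obtain ⟨u, hu⟩ := ih2 (by omega)
      have e1 : (m + 1 + 1) • P + P = (m + 2 + 1) • P := by rw [← succ_nsmul]
      have e2 : (m + 1 + 1) • P - P = (m + 1) • P := by rw [succ_nsmul _ (m + 1), add_sub_cancel_right]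
      obtain ⟨w, hw⟩ := hV.exists_inv_abscissa_add (Q := (m + 1 + 1) • P) hP0
        (hne _ (by omega) (by omega)) (by rw [e1]; exact hne _ (by omega) h)
        (by rw [e2]; exact hne _ (by omega) (by omega)) htm hxt
        (q := ((m + 1 + 1 : ℕ) : A) ^ 2 + t * u) (by ring) hu (by rw [e2]; exact hu')
      rw [e1] at hw
      refine ⟨2 * u - u' + w, ?_⟩
      rw [← hw]
      congr 2
      push_cast
      ring
  obtain ⟨u, hu⟩ := key k (by omega)
  obtain ⟨u', hu'⟩ := key (k - 1) (by omega)
  rw [show k - 1 + 1 = k by omega] at hu'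
  -- With N = 2k + 1, the points kP and (k + 1)P share their abscissa, so (k + 1)² ≡ k² modulo t.
  -- Thus N lies in the maximal ideal, although it is a unit.
  have hsum : (k + 1) • P = -(k • P) := by
    rw [eq_neg_iff_add_eq_zero, ← add_nsmul, show k + 1 + k = N by omega]
    exact addOrderOf_nsmul_eq_zero P
  rw [hsum, abscissa_neg] at hu
  have heq : ((k + 1 : ℕ) : A) ^ 2 * t + t ^ 2 * u = (k : A) ^ 2 * t + t ^ 2 * u' := by
    refine Subtype.val_injective (mul_left_cancel₀ ?_ (hu.trans hu'.symm))
    intro h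
    rw [h, zero_mul] at hu'
    exact zero_ne_one hu'
  have ht0 : t ≠ 0 := by
    intro h
    rw [h] at hxt
    simp at hxt
  have hfin : (N : A) = t * (u' - u) := by
    refine mul_left_cancel₀ ht0 ?_
    rw [hk]
    push_cast at heq ⊢
    linear_combination heq
  exact (hfin ▸ Ideal.mul_mem_right _ _ htm : (N : A) ∈ IsLocalRing.maximalIdeal A) hNu

/-- Points with integral abscissas that are congruent modulo the maximal ideal differ by a sign, or
their sum or difference has non-integral abscissa, at a valuation ring of good reduction. -/
theorem residue_ne_residue (hV : IsCubicModel V (a : K) b c) {P Q : V.Point} (hP : P ≠ 0)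
    (hQ : Q ≠ 0) (h1 : P + Q ≠ 0) (h2 : P - Q ≠ 0) {x z s d : A} (hx : P.abscissa = x)
    (hz : Q.abscissa = z) (hs : (P + Q).abscissa = s) (hd : (P - Q).abscissa = d)
    (h2u : IsLocalRing.residue A 2 ≠ 0)
    (hgood : IsLocalRing.residue A (x ^ 3 + a * x ^ 2 + b * x + c) = 0 →
      IsLocalRing.residue A (3 * x ^ 2 + 2 * a * x + b) ≠ 0) :
    IsLocalRing.residue A x ≠ IsLocalRing.residue A z := by
  obtain ⟨-, hS, hM⟩ := hV.abscissa_add_sub hP hQ h1 h2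
  rw [hx, hz, hs, hd] at hS hM
  have hS' : (s + d) * (x - z) ^ 2 =
      2 * (x * z * (x + z) + 2 * a * (x * z) + b * (x + z) + 2 * c) :=
    Subtype.val_injective (by push_cast; simp only [coe_two]; exact hS)
  have hM' : s * d * (x - z) ^ 2 = (x * z - b) ^ 2 - 4 * c * (x + z + a) :=
    Subtype.val_injective (by push_cast; simp only [coe_four]; exact hM)
  intro h
  have hS2 := congrArg (IsLocalRing.residue A) hS'
  have hM2 := congrArg (IsLocalRing.residue A) hM'
  simp only [map_mul, map_add, map_sub, map_pow, map_ofNat, ← h] at hS2 hM2 hgood h2u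
  set X := IsLocalRing.residue A x
  have hf : X ^ 3 + IsLocalRing.residue A a * X ^ 2 + IsLocalRing.residue A b * X +
      IsLocalRing.residue A c = 0 := by
    refine (mul_eq_zero.mp ?_).resolve_left (mul_ne_zero h2u h2u)
    linear_combination -hS2
  -- The right side of the product formula at x = z is f'(x)² - (8x + 4a) f(x), with f the cubic,
  -- and the sum formula has already given f(X) = 0.
  refine hgood hf (pow_eq_zero_iff two_ne_zero |>.mp ?_)
  linear_combination -hM2 + (8 * X + 4 * IsLocalRing.residue A a) * hf

end IsCubicModel

/-! ### Reduction of rational abscissas modulo a prime -/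

/-- The affine points with rational abscissa whose order is finite, odd and prime to `p`. -/
def IsRatTorsion {K : Type*} [Field K] [DecidableEq K] [Algebra ℚ K]
    {V : WeierstrassCurve.Affine K} (p : ℕ) (P : V.Point) : Prop :=
  P ≠ 0 ∧ P.abscissa ∈ (algebraMap ℚ K).range ∧ ∃ n : ℕ, Odd n ∧ n.Coprime p ∧ n • P = 0

/-- The proper ideal pℤ of the subring ℤ of K is dominated by a valuation ring of K. No information
on the splitting of p is needed. -/
theorem exists_valuationSubring_of_prime (K : Type*) [Field K] [CharZero K] {p : ℕ}
    (hp : p.Prime) : ∃ A : ValuationSubring K, IsLocalRing.residue A (p : A) = 0 := by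
  set R : Subring K := (Int.castRingHom K).range
  have hI : Ideal.span {((p : ℕ) : R)} ≠ ⊤ := by
    rw [Ne, Ideal.span_singleton_eq_top, isUnit_iff_exists_inv]
    rintro ⟨⟨_, m, rfl⟩, h⟩
    have h' := congrArg (Subtype.val : R → K) h
    simp only [Subring.coe_mul, Subring.coe_one, Subring.coe_natCast, Int.coe_castRingHom] at h'
    have h2 : (p : ℤ) * m = 1 := by exact_mod_cast h'
    have h3 := Int.natAbs_of_isUnit (IsUnit.of_mul_eq_one _ h2)
    exact hp.one_lt.ne' (by simpa using h3)
  obtain ⟨A, -, hA⟩ := Ideal.image_subset_nonunits_valuationSubring _ hI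
  refine ⟨A, ?_⟩
  have hpA : ((p : ℕ) : K) ∈ A.nonunits :=
    hA ⟨_, Ideal.mem_span_singleton_self _, by simp⟩
  rw [IsLocalRing.residue_eq_zero_iff]
  obtain ⟨h, h'⟩ := ValuationSubring.mem_nonunits_iff_exists_mem_maximalIdeal.mp hpA
  exact (show (⟨(p : K), h⟩ : A) = (p : A) from Subtype.ext (by simp)) ▸ h'

/-- The cubic `x³ + a x² + b x + c` has no double roots modulo `p`. -/
abbrev IsSeparableMod (a b c : ℤ) (p : ℕ) : Prop :=
  ∀ r : ZMod p, r ^ 3 + a * r ^ 2 + b * r + c = 0 → 3 * r ^ 2 + 2 * a * r + b ≠ 0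

/-- The relation between the abscissas `r` of `P` and `s` of `2 P`. -/
abbrev IsDuplicate {R : Type*} [CommRing R] (a b c : ℤ) (r s : R) : Prop :=
  s * (4 * (r ^ 3 + a * r ^ 2 + b * r + c)) =
    r ^ 4 - 2 * b * r ^ 2 - 8 * c * r + b ^ 2 - 4 * a * c

namespace IsCubicModel

variable {K : Type*} [Field K] [Algebra ℚ K]

/-- The residue field may be larger than `ZMod p`, but a rational abscissa always reduces into the
prime field: its denominator is a unit, since otherwise p would divide numerator and denominator. -/
theorem residue_rat {A : ValuationSubring K} {p : ℕ} [Fact p.Prime]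
    [CharP (IsLocalRing.ResidueField A) p] (q : ℚ) (hq : algebraMap ℚ K q ∈ A) :
    IsLocalRing.residue A ⟨algebraMap ℚ K q, hq⟩ =
      ZMod.castHom dvd_rfl (IsLocalRing.ResidueField A) ((q.num : ZMod p) / (q.den : ZMod p)) := by
  have h1 : (⟨algebraMap ℚ K q, hq⟩ : A) * (q.den : A) = (q.num : A) := by
    refine Subtype.ext ?_
    have := congrArg (algebraMap ℚ K) (Rat.mul_den_eq_num q)
    rw [map_mul, map_natCast, map_intCast] at this
    change algebraMap ℚ K q * ((q.den : A) : K) = ((q.num : A) : K)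
    exact_mod_cast this
  have h2 := congrArg (IsLocalRing.residue A) h1
  simp only [map_mul, map_natCast, map_intCast] at h2
  have hden : (q.den : IsLocalRing.ResidueField A) ≠ 0 := by
    intro h0
    rw [h0, mul_zero] at h2
    have d1 : (p : ℤ) ∣ q.num := (CharP.intCast_eq_zero_iff _ p _).mp h2.symm
    have d2 : p ∣ q.den := (CharP.cast_eq_zero_iff _ p _).mp h0
    have d3 := Nat.dvd_gcd (Int.natCast_dvd.mp d1) d2
    rw [q.reduced] at d3
    exact (Fact.out : p.Prime).one_lt.ne' (Nat.dvd_one.mp d3)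
  rw [map_div₀, map_intCast, map_natCast, eq_div_iff hden]
  exact h2

end IsCubicModel

namespace IsRatTorsion

variable {K : Type*} [Field K] [DecidableEq K] [Algebra ℚ K] {V : WeierstrassCurve.Affine K}

theorem add_self_ne_zero {P : V.Point} {p : ℕ} (hP : IsRatTorsion p P) : P + P ≠ 0 := by
  obtain ⟨h0, -, n, ⟨k, rfl⟩, -, hn⟩ := hP
  intro h
  rw [← two_nsmul] at h
  rw [add_nsmul, mul_comm, mul_nsmul', h] at hn
  simp only [nsmul_zero, one_nsmul, zero_add] at hn
  exact h0 hn

theorem add_self {a b c : ℤ} (hV : IsCubicModel V (a : K) b c) {P : V.Point} {p : ℕ}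
    (hP : IsRatTorsion p P) : IsRatTorsion p (P + P) := by
  have h2 := hP.add_self_ne_zero
  obtain ⟨h0, ⟨q, hq⟩, n, hn, hnp, hnP⟩ := hP
  refine ⟨h2, ⟨(q ^ 4 - 2 * b * q ^ 2 - 8 * c * q + b ^ 2 - 4 * a * c) /
    (4 * (q ^ 3 + a * q ^ 2 + b * q + c)), ?_⟩, n, hn, hnp, by rw [nsmul_add, hnP, add_zero]⟩
  obtain ⟨h4, hx⟩ := hV.abscissa_add_self h0 h2
  rw [← hq] at h4 hx
  rw [← eq_div_iff h4] at hx
  rw [hx]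
  simp only [map_div₀, map_mul, map_add, map_sub, map_pow, map_intCast, map_ofNat]

end IsRatTorsion

namespace IsCubicModel

variable {K : Type*} [Field K] [DecidableEq K] [Algebra ℚ K] {V : WeierstrassCurve.Affine K}

/-- Reduction modulo a prime `p` of good reduction: it is injective up to sign on torsion points
with rational abscissa and order prime to `2 p`, and it respects duplication. -/
theorem exists_reduction {a b c : ℤ} (hV : IsCubicModel V (a : K) b c) (p : ℕ) [hp : Fact p.Prime]
    (hp2 : p ≠ 2) (hgood : IsSeparableMod a b c p) :
    ∃ red : V.Point → ZMod p,
      (∀ P Q : V.Point, IsRatTorsion p P → IsRatTorsion p Q → red P = red Q → P = Q ∨ P = -Q) ∧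
      (∀ P : V.Point, IsRatTorsion p P →
        IsDuplicate a b c (red P) (red (P + P))) ∧
      (∀ P Q : V.Point, IsRatTorsion p P → IsRatTorsion p Q → P.abscissa = Q.abscissa →
        red P = red Q) ∧
      ∀ P : V.Point, IsRatTorsion p P → ∀ n : ℤ, P.abscissa = (n : K) → red P = n := by
  have : CharZero K := algebraRat.charZero K
  obtain ⟨A, hA⟩ := exists_valuationSubring_of_prime K hp.out
  have : CharP (IsLocalRing.ResidueField A) p :=
    (CharP.charP_iff_prime_eq_zero hp.out).mpr (by rwa [map_natCast] at hA)
  have hV' : IsCubicModel V (((a : A) : K)) ((b : A) : K) ((c : A) : K) := by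
    simpa using hV
  have hunit : ∀ n : ℕ, n.Coprime p → IsUnit (n : A) := by
    intro n hn
    rw [← IsLocalRing.residue_ne_zero_iff_isUnit, map_natCast, Ne, CharP.cast_eq_zero_iff _ p]
    intro h
    exact hp.out.one_lt.ne' (Nat.dvd_one.mp (hn ▸ Nat.dvd_gcd h dvd_rfl))
  have hmem : ∀ P : V.Point, (∃ n : ℕ, Odd n ∧ n.Coprime p ∧ n • P = 0) → P.abscissa ∈ A := by
    rintro P ⟨n, hn, hnp, hnP⟩
    exact hV'.abscissa_mem hn hnP (hunit n hnp)
  set ι := ZMod.castHom (dvd_refl p) (IsLocalRing.ResidueField A) with hι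
  have hex : ∀ P : V.Point, IsRatTorsion p P → ∃ r, ∀ h : P.abscissa ∈ A,
      IsLocalRing.residue A ⟨P.abscissa, h⟩ = ι r := by
    rintro P ⟨-, ⟨q, hq⟩, -⟩
    refine ⟨(q.num : ZMod p) / (q.den : ZMod p), fun h ↦ ?_⟩
    have h' : algebraMap ℚ K q ∈ A := hq ▸ h
    rw [← residue_rat q h']
    congr 2
    exact hq.symm
  -- The value of `red` is arbitrary away from `IsRatTorsion p`.
  choose! red hred using hex
  have i2 : ι 2 = 2 := map_ofNat ι 2
  have i3 : ι 3 = 3 := map_ofNat ι 3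
  have i4 : ι 4 = 4 := map_ofNat ι 4
  have i8 : ι 8 = 8 := map_ofNat ι 8
  have hι_inj : Function.Injective ι := ι.injective
  refine ⟨red, ?_, ?_, ?_, ?_⟩
  · intro P Q hP hQ h
    by_contra! hne
    have h1 : P + Q ≠ 0 := fun H ↦ hne.2 (eq_neg_of_add_eq_zero_left H)
    have h2 : P - Q ≠ 0 := fun H ↦ hne.1 (sub_eq_zero.mp H)
    obtain ⟨n, hn, hnp, hnP⟩ := hP.2.2
    obtain ⟨m, hm, hmp, hmQ⟩ := hQ.2.2
    have hnm : Odd (n * m) ∧ (n * m).Coprime p := ⟨hn.mul hm, hnp.mul_left hmp⟩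
    have z1 : (n * m) • P = 0 := by rw [mul_comm, mul_nsmul', hnP, nsmul_zero]
    have z2 : (n * m) • Q = 0 := by rw [mul_nsmul', hmQ, nsmul_zero]
    have hPA := hmem P hP.2.2
    have hQA := hmem Q hQ.2.2
    have hSA := hmem (P + Q) ⟨_, hnm.1, hnm.2, by rw [nsmul_add, z1, z2, add_zero]⟩
    have hDA := hmem (P - Q) ⟨_, hnm.1, hnm.2, by rw [nsmul_sub, z1, z2, sub_zero]⟩
    refine hV'.residue_ne_residue hP.1 hQ.1 h1 h2 (x := ⟨_, hPA⟩) (z := ⟨_, hQA⟩)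
      (s := ⟨_, hSA⟩) (d := ⟨_, hDA⟩) rfl rfl rfl rfl ?_ ?_ ?_
    · have := hunit 2 ((Nat.coprime_primes Nat.prime_two hp.out).mpr hp2.symm)
      rw [← IsLocalRing.residue_ne_zero_iff_isUnit] at this
      exact_mod_cast this
    · intro h0 h3
      refine hgood (red P) (hι_inj ?_) (hι_inj ?_)
      · simp only [map_add, map_mul, map_pow, map_intCast, hred P hP hPA] at h0
        simpa using h0
      · simp only [map_add, map_mul, map_pow, map_intCast, map_ofNat, hred P hP hPA] at h3
        simpa [i2, i3] using h3
    · rw [hred P hP, hred Q hQ, h]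
  · intro P hP
    have hP2 := hP.add_self hV
    have hPA := hmem P hP.2.2
    have hSA := hmem (P + P) hP2.2.2
    obtain ⟨-, hx⟩ := hV'.abscissa_add_self hP.1 hP2.1
    have hxA : (⟨_, hSA⟩ : A) * (4 * ((⟨_, hPA⟩ : A) ^ 3 + (a : A) * (⟨_, hPA⟩ : A) ^ 2 +
        (b : A) * (⟨_, hPA⟩ : A) + (c : A))) = (⟨_, hPA⟩ : A) ^ 4 -
          2 * (b : A) * (⟨_, hPA⟩ : A) ^ 2 - 8 * (c : A) * (⟨_, hPA⟩ : A) + (b : A) ^ 2 -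
          4 * (a : A) * (c : A) := Subtype.ext hx
    have hxr := congrArg (IsLocalRing.residue A) hxA
    simp only [map_add, map_sub, map_mul, map_pow, map_intCast, map_ofNat, hred P hP,
      hred _ hP2] at hxr
    refine hι_inj ?_
    simpa [i2, i4, i8] using hxr
  · intro P Q hP hQ h
    refine hι_inj ?_
    rw [← hred P hP (hmem P hP.2.2), ← hred Q hQ (hmem Q hQ.2.2)]
    simp only [h]
  · intro P hP n hn
    have hPA := hmem P hP.2.2
    refine hι_inj ?_
    rw [← hred P hP hPA, map_intCast, ← map_intCast (IsLocalRing.residue A)]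
    congr 1
    exact Subtype.ext (by simpa using hn)

end IsCubicModel

/-! ### Excluding points of prime order with rational abscissa -/

namespace IsCubicModel

variable {K : Type*} [Field K] [DecidableEq K] [Algebra ℚ K] {V : WeierstrassCurve.Affine K}
  {a b c : ℤ}

/-- The ordinate may be irrational, so the addition law does not apply directly. But x(Q + P) + x(Q
- P) is rational in x(Q) and x(P), which gives a two-step recursion. -/
theorem abscissa_nsmul_mem_range (hV : IsCubicModel V (a : K) b c) {P : V.Point}
    (hP : P.abscissa ∈ (algebraMap ℚ K).range) (n : ℕ) :
    (n • P).abscissa ∈ (algebraMap ℚ K).range := by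
  have h0 : (0 : V.Point).abscissa ∈ (algebraMap ℚ K).range := zero_mem _
  have hdiv : ∀ {u w z : K}, u ∈ (algebraMap ℚ K).range → w ∈ (algebraMap ℚ K).range → w ≠ 0 →
      z * w = u → z ∈ (algebraMap ℚ K).range := by
    rintro _ _ z ⟨u, rfl⟩ ⟨w, rfl⟩ hw h
    exact ⟨u / w, by rw [map_div₀, eq_comm, eq_div_iff hw, h]⟩
  have hi : ∀ m : ℤ, (m : K) ∈ (algebraMap ℚ K).range := fun m ↦ ⟨m, map_intCast _ m⟩
  have h2 : (2 : K) ∈ (algebraMap ℚ K).range := by simp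
  have h4 : (4 : K) ∈ (algebraMap ℚ K).range := by simp
  have h8 : (8 : K) ∈ (algebraMap ℚ K).range := by simp
  by_cases hP0 : P = 0
  · rwa [hP0, nsmul_zero]
  have hdbl : (P + P).abscissa ∈ (algebraMap ℚ K).range := by
    by_cases hPP : P + P = 0
    · rwa [hPP]
    obtain ⟨hne, hx⟩ := hV.abscissa_add_self hP0 hPP
    refine hdiv ?_ ?_ hne hx
    · exact sub_mem (add_mem (sub_mem (sub_mem (pow_mem hP 4) (mul_mem (mul_mem h2 (hi b))
        (pow_mem hP 2))) (mul_mem (mul_mem h8 (hi c)) hP)) (pow_mem (hi b) 2))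
        (mul_mem (mul_mem h4 (hi a)) (hi c))
    · exact mul_mem h4 (add_mem (add_mem (add_mem (pow_mem hP 3) (mul_mem (hi a) (pow_mem hP 2)))
        (mul_mem (hi b) hP)) (hi c))
  induction n using Nat.twoStepInduction with
  | zero => rwa [zero_nsmul]
  | one => rwa [one_nsmul]
  | more m ih1 ih2 =>
    have e1 : (m + 2) • P = (m + 1) • P + P := by rw [← succ_nsmul]
    have e2 : m • P = (m + 1) • P - P := by rw [succ_nsmul, add_sub_cancel_right]
    rw [e1]
    rw [e2] at ih1
    generalize (m + 1) • P = Q at *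
    by_cases hQ : Q = 0
    · rwa [hQ, zero_add]
    by_cases hs : Q + P = 0
    · rwa [hs]
    by_cases hd : Q - P = 0
    · rwa [sub_eq_zero.mp hd]
    obtain ⟨hne, hx, -⟩ := hV.abscissa_add_sub hQ hP0 hs hd
    have hsum : (Q + P).abscissa + (Q - P).abscissa ∈ (algebraMap ℚ K).range := by
      refine hdiv ?_ (pow_mem (sub_mem ih2 hP) 2) (pow_ne_zero 2 (sub_ne_zero.mpr hne)) hx
      have hxz := mul_mem ih2 hP
      have hxz' := add_mem ih2 hP
      exact mul_mem h2 (add_mem (add_mem (add_mem (mul_mem hxz hxz') (mul_mem (mul_mem h2 (hi a))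
        hxz)) (mul_mem (hi b) hxz')) (mul_mem h2 (hi c)))
    have := sub_mem hsum ih1
    rwa [add_sub_cancel_right] at this

/-- If there is no point of order `p` with rational abscissa then all torsion points of odd order
with rational abscissa have order prime to `p`. -/
theorem isRatTorsion_of_forall (hV : IsCubicModel V (a : K) b c) {p : ℕ} (hp : p.Prime)
    (h : ∀ Q : V.Point, Q ≠ 0 → p • Q = 0 → Q.abscissa ∉ (algebraMap ℚ K).range) {P : V.Point}
    (hP : IsRatTorsion 1 P) : IsRatTorsion p P := by
  -- Coprimality to 1 is vacuous: `IsRatTorsion 1` only asks for odd order.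
  obtain ⟨h0, hx, n, hn, -, hnP⟩ := hP
  refine ⟨h0, hx, addOrderOf P, hn.of_dvd_nat (addOrderOf_dvd_of_nsmul_eq_zero hnP), ?_,
    addOrderOf_nsmul_eq_zero P⟩
  by_contra hcop
  obtain ⟨k, hk⟩ : p ∣ addOrderOf P := by
    by_contra hdvd
    exact hcop ((Nat.Prime.coprime_iff_not_dvd hp).mpr hdvd).symm
  refine h (k • P) ?_ ?_ (hV.abscissa_nsmul_mem_range hx k)
  · intro hk0
    have hpos : 0 < addOrderOf P :=
      Nat.pos_of_dvd_of_pos (addOrderOf_dvd_of_nsmul_eq_zero hnP) hn.pos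
    have hk' : 0 < k := Nat.pos_of_ne_zero (by rintro rfl; omega)
    have := Nat.le_of_dvd hk' (addOrderOf_dvd_of_nsmul_eq_zero hk0)
    have h2 := hp.two_le
    nlinarith
  · rw [← mul_nsmul', ← hk, addOrderOf_nsmul_eq_zero]

omit [Algebra ℚ K] in
-- Since 2P = -P, the duplication formula fixes x; clearing denominators gives the 3-division
-- polynomial.
theorem eq_zero_of_three_nsmul (hV : IsCubicModel V (a : K) b c) {P : V.Point} (hP : P ≠ 0)
    (h : 3 • P = 0) {x : K} (hx : P.abscissa = x) :
    3 * x ^ 4 + 4 * a * x ^ 3 + 6 * b * x ^ 2 + 12 * c * x + (4 * a * c - b ^ 2) = 0 := by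
  have h2 : P + P = -P := by
    rw [eq_neg_iff_add_eq_zero, ← h]
    abel
  obtain ⟨-, hx2⟩ := hV.abscissa_add_self hP (by rwa [h2, neg_ne_zero])
  rw [h2, abscissa_neg, hx] at hx2
  linear_combination hx2

theorem abscissa_notMem_range_of_three_nsmul (hV : IsCubicModel V (a : K) b c)
    (h : ∀ x : ℚ, 3 * x ^ 4 + 4 * a * x ^ 3 + 6 * b * x ^ 2 + 12 * c * x + (4 * a * c - b ^ 2) ≠ 0)
    (P : V.Point) (hP : P ≠ 0) (h3 : 3 • P = 0) : P.abscissa ∉ (algebraMap ℚ K).range := by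
  rintro ⟨x, hx⟩
  refine h x ((algebraMap ℚ K).injective ?_)
  simp only [map_add, map_sub, map_mul, map_pow, map_intCast, map_ofNat, map_zero]
  exact hV.eq_zero_of_three_nsmul hP h3 hx.symm

/-- Duplication cycles in the reduction modulo `q` rule out points of order `p`. -/
theorem abscissa_notMem_range_of_nsmul (hV : IsCubicModel V (a : K) b c) (q : ℕ)
    [hq : Fact q.Prime] (hq2 : q ≠ 2) (hgood : IsSeparableMod a b c q) {p k : ℕ} (hp : p.Prime) (hp3 : 3 < p) (hpq : p ≠ q)
    (hk : p ∣ 2 ^ k - 1 ∨ p ∣ 2 ^ k + 1)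
    (hcycle : ∀ s : ℕ → ZMod q, (∀ i, IsDuplicate a b c (s i) (s (i + 1))) → s k = s 0 → s 1 = s 0)
    (P : V.Point) (hP : P ≠ 0) (hpP : p • P = 0) : P.abscissa ∉ (algebraMap ℚ K).range := by
  intro hx
  obtain ⟨red, hinj, hdbl, heq, -⟩ := hV.exists_reduction q hq2 hgood
  have hT : IsRatTorsion q P := ⟨hP, hx, p, hp.odd_of_ne_two (by omega),
    (Nat.coprime_primes hp hq.out).mpr hpq, hpP⟩
  have hTi : ∀ i : ℕ, IsRatTorsion q (2 ^ i • P) := by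
    intro i
    induction i with
    | zero => simpa using hT
    | succ i ih =>
      rw [pow_succ, mul_comm, mul_nsmul', two_nsmul]
      exact ih.add_self hV
  -- As 2 ^ k ≡ ±1 modulo p, the orbit of abscissas closes up after k doublings.
  have hk' : (2 ^ k • P).abscissa = P.abscissa := by
    rcases hk with ⟨m, hm⟩ | ⟨m, hm⟩
    · have : 2 ^ k = m * p + 1 := by
        have := Nat.one_le_two_pow (n := k)
        rw [mul_comm] at hm
        omega
      rw [this, succ_nsmul, mul_nsmul', hpP, nsmul_zero, zero_add]
    · have : 2 ^ k • P = -P := by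
        rw [eq_neg_iff_add_eq_zero, ← succ_nsmul, hm, mul_comm, mul_nsmul', hpP, nsmul_zero]
      rw [this, abscissa_neg]
  have h1 := hcycle (fun i ↦ red (2 ^ i • P)) (fun i ↦ by
    have := hdbl _ (hTi i)
    rwa [← two_nsmul, ← mul_nsmul', ← pow_succ'] at this)
    (heq _ _ (hTi k) (hTi 0) (by rw [hk', pow_zero, one_nsmul]))
  -- A stationary orbit means 2P = ±P, and this is impossible for a point of prime order p > 3.
  have h3 : 3 • P = 0 := by
    rcases hinj _ _ (hTi 1) (hTi 0) h1 with h | h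
    · rw [pow_one, pow_zero, two_nsmul, one_nsmul, add_eq_left] at h
      exact absurd h hP
    · rw [pow_one, pow_zero, one_nsmul, eq_neg_iff_add_eq_zero, ← succ_nsmul] at h
      exact h
  have hdvd := Nat.dvd_gcd (addOrderOf_dvd_of_nsmul_eq_zero h3) (addOrderOf_dvd_of_nsmul_eq_zero hpP)
  rw [(Nat.coprime_primes Nat.prime_three hp).mpr hp3.ne] at hdvd
  exact hP (AddMonoid.addOrderOf_eq_one_iff.mp (Nat.dvd_one.mp hdvd))

end IsCubicModel

/-! ### Torsion over quadratic fields -/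

/-- The Weierstrass curve `y² = x³ + a x² + b x + c` over `ℚ` with integral coefficients. -/
def cubicModel (a b c : ℤ) : WeierstrassCurve ℚ :=
  ⟨0, a, 0, b, c⟩

theorem isCubicModel_baseChange (a b c : ℤ) (K : Type*) [Field K] [Algebra ℚ K] :
    IsCubicModel ((cubicModel a b c).baseChange K).toAffine (a : K) b c := by
  constructor <;> simp [cubicModel, WeierstrassCurve.baseChange, WeierstrassCurve.map]

/-- A quadratic extension of `ℚ` has an involution whose fixed field is `ℚ`. -/
theorem exists_conjugation (K : Type*) [Field K] [Algebra ℚ K] (hK : Module.finrank ℚ K = 2) :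
    ∃ σ : K →ₐ[ℚ] K, (∀ x, σ (σ x) = x) ∧ ∀ x, σ x = x → x ∈ (algebraMap ℚ K).range := by
  have : Algebra.IsQuadraticExtension ℚ K := ⟨hK⟩
  have hfin : FiniteDimensional ℚ K := inferInstance
  have hcard : Nat.card Gal(K/ℚ) = 2 := by rw [IsGalois.card_aut_eq_finrank, hK]
  have hprime : Fact (Nat.Prime 2) := ⟨Nat.prime_two⟩
  obtain ⟨σ, hσ⟩ : ∃ σ : Gal(K/ℚ), σ ≠ 1 := by
    have : Nontrivial Gal(K/ℚ) := Finite.one_lt_card_iff_nontrivial.mp (by omega)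
    exact exists_ne 1
  have htop : ∀ τ : Gal(K/ℚ), τ ∈ Subgroup.zpowers σ := fun τ ↦ by
    rw [zpowers_eq_top_of_prime_card hcard hσ]
    trivial
  refine ⟨σ, fun x ↦ ?_, fun x hx ↦ ?_⟩
  · have h : σ ^ 2 = 1 := hcard ▸ pow_card_eq_one'
    exact congrArg (fun τ : Gal(K/ℚ) ↦ τ x) h
  · refine (IsGalois.mem_range_algebraMap_iff_fixed x).mpr fun τ ↦ ?_
    have : Subgroup.zpowers σ ≤ MulAction.stabilizer Gal(K/ℚ) x := by
      rw [Subgroup.zpowers_le]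
      exact hx
    exact this (htop τ)

/-- Conjugation must negate square roots α of r and β of s, hence fixes αβ, and rs would be a
rational square. -/
theorem not_isSquare_and_isSquare {K : Type*} [Field K] [Algebra ℚ K]
    (hK : Module.finrank ℚ K = 2) {r s : ℤ} (hr : ¬ IsSquare r) (hs : ¬ IsSquare s)
    (hrs : ¬ IsSquare (r * s)) : ¬ (IsSquare (r : K) ∧ IsSquare (s : K)) := by
  obtain ⟨σ, -, hσ⟩ := exists_conjugation K hK
  have key : ∀ {n : ℤ} {α : K}, (n : K) = α * α → σ α = α → IsSquare n := by
    intro n α hn hα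
    obtain ⟨q, hq⟩ := hσ α hα
    rw [← Rat.isSquare_intCast_iff]
    refine ⟨q, (algebraMap ℚ K).injective ?_⟩
    rw [map_mul, hq, ← hn, map_intCast]
  have hpm : ∀ {n : ℤ} {α : K}, (n : K) = α * α → σ α = α ∨ σ α = -α := by
    intro n α hn
    refine mul_self_eq_mul_self_iff.mp ?_
    rw [← map_mul, ← hn, map_intCast]
  rintro ⟨⟨α, hα⟩, ⟨β, hβ⟩⟩
  rcases hpm hα with h1 | h1
  · exact hr (key hα h1)
  rcases hpm hβ with h2 | h2
  · exact hs (key hβ h2)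
  refine hrs (key (α := α * β) ?_ (by rw [map_mul, h1, h2, neg_mul_neg]))
  push_cast
  rw [hα, hβ]
  ring

section Quadratic

variable {a b c : ℤ} {K : Type*} [Field K] [DecidableEq K] [Algebra ℚ K]

theorem abscissa_map (E : WeierstrassCurve ℚ) (σ : K →ₐ[ℚ] K)
    (P : (E.baseChange K).toAffine.Point) :
    (Point.map (W' := E.toAffine) σ P).abscissa = σ P.abscissa := by
  cases P with
  | zero => exact (map_zero σ).symm
  | some x y h => rfl

theorem map_pointInclusion (E : WeierstrassCurve ℚ) (σ : K →ₐ[ℚ] K)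
    (P : (E.baseChange ℚ).toAffine.Point) :
    Point.map (W' := E.toAffine) σ (pointInclusion E K P) = pointInclusion E K P :=
  Point.map_baseChange (W' := E.toAffine) σ P

theorem map_map_of_involutive (E : WeierstrassCurve ℚ) {σ : K →ₐ[ℚ] K} (hσ : ∀ x, σ (σ x) = x)
    (P : (E.baseChange K).toAffine.Point) :
    Point.map (W' := E.toAffine) σ (Point.map (W' := E.toAffine) σ P) = P := by
  cases P with
  | zero => rfl
  | some x y h =>
    rw [Point.map_some, Point.map_some]
    simp only [hσ]

/-- A subgroup of rational points which contains all torsion points of odd order with rational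
abscissa and which is closed under halving contains all torsion points over a quadratic field. -/
theorem torsionPoints_le (E : WeierstrassCurve ℚ) (hK : Module.finrank ℚ K = 2)
    {R : AddSubgroup (E.baseChange K).toAffine.Point} (hR : R ≤ (pointInclusion E K).range)
    (hodd : ∀ P, IsRatTorsion 1 P → P ∈ R) (hhalf : ∀ P, P + P ∈ R → P ∈ R) :
    torsionPoints E K ≤ R := by
  obtain ⟨σ, hσ2, hσ⟩ := exists_conjugation K hK
  have hodd' : ∀ (n : ℕ) (P : (E.baseChange K).toAffine.Point), Odd n → n • P = 0 → P ∈ R := by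
    intro n P hn hnP
    set σP := Point.map (W' := E.toAffine) σ P with hσP
    have hnσ : n • σP = 0 := by rw [hσP, ← map_nsmul, hnP, _root_.map_zero]
    by_cases hQ : P - σP = 0
    · by_cases hP0 : P = 0
      · exact hP0 ▸ zero_mem R
      refine hodd P ⟨hP0, hσ _ ?_, n, hn, Nat.coprime_one_right n, hnP⟩
      rw [← abscissa_map, ← hσP, ← sub_eq_zero.mp hQ]
    -- A nonzero D = P - σP is negated by σ, so it lies in R by `hodd` and is fixed by σ. Then D + D
    -- = 0, contrary to odd order.
    · have hmap : Point.map (W' := E.toAffine) σ (P - σP) = -(P - σP) := by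
        rw [_root_.map_sub, hσP, map_map_of_involutive E hσ2, neg_sub]
      have hT : IsRatTorsion 1 (P - σP) := by
        refine ⟨hQ, hσ _ ?_, n, hn, Nat.coprime_one_right n, by
          rw [nsmul_sub, hnP, hnσ, sub_zero]⟩
        rw [← abscissa_map, hmap, IsCubicModel.abscissa_neg]
      obtain ⟨Q, hQ'⟩ := hR (hodd _ hT)
      refine absurd ?_ hT.add_self_ne_zero
      rw [← hQ', map_pointInclusion, hQ'] at hmap
      exact eq_neg_iff_add_eq_zero.mp hmap
  intro P hP
  have hP' : 0 < addOrderOf P := IsOfFinAddOrder.addOrderOf_pos hP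
  obtain ⟨k, m, hm, hkm⟩ := Nat.exists_eq_two_pow_mul_odd hP'.ne'
  have hpow : ∀ (k : ℕ) (Q : (E.baseChange K).toAffine.Point), 2 ^ k • Q ∈ R → Q ∈ R := by
    intro k
    induction k with
    | zero => simp
    | succ k ih =>
      intro Q hQ
      rw [pow_succ, mul_nsmul', two_nsmul] at hQ
      exact hhalf _ (ih _ hQ)
  refine hpow k P (hodd' m _ hm ?_)
  rw [← mul_nsmul', mul_comm, ← hkm, addOrderOf_nsmul_eq_zero]

/-- It suffices to test one representative per class of R/2R: replacing P by P - S' changes its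
double by 2S'. If the class is trivial, P - S' is 2-torsion. -/
theorem mem_of_add_self_mem {A : Type*} [AddCommGroup A] {R : AddSubgroup A}
    (h2 : ∀ P : A, P + P = 0 → P ∈ R)
    (hrep : ∀ S ∈ R, ∃ S' ∈ R, S = S' + S' ∨ ∀ P : A, P + P ≠ S - (S' + S')) (P : A)
    (hP : P + P ∈ R) : P ∈ R := by
  obtain ⟨S', hS', h⟩ := hrep _ hP
  rcases h with h | h
  · have h0 := h2 (P - S') (by rw [← sub_eq_zero] at h; rw [← h]; abel)
    simpa using add_mem h0 hS'
  · exact absurd (by abel) (h (P - S'))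

/-- A model without rational points of order two has none over quadratic fields. -/
theorem eq_zero_of_add_self_eq_zero (hK : Module.finrank ℚ K = 2)
    (hroot : ∀ x : ℚ, x ^ 3 + a * x ^ 2 + b * x + c ≠ 0)
    {P : ((cubicModel a b c).baseChange K).toAffine.Point} (hP : P + P = 0) : P = 0 := by
  have : CharZero K := algebraRat.charZero K
  have hV := isCubicModel_baseChange a b c K
  obtain ⟨σ, hσ2, hσ⟩ := exists_conjugation K hK
  have key : ∀ Q : ((cubicModel a b c).baseChange K).toAffine.Point, Q + Q = 0 →
      Point.map (W' := (cubicModel a b c).toAffine) σ Q = Q → Q = 0 := by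
    intro Q hQ hfix
    cases Q with
    | zero => rfl
    | some x y h =>
      exfalso
      have hy : y = 0 := by simpa using (hV.add_self_eq_zero_iff h).mp hQ
      have he := (hV.equation_iff x y).mp h.1
      obtain ⟨q, rfl⟩ := hσ x (Point.some.inj hfix).1
      refine hroot q ((algebraMap ℚ K).injective ?_)
      simp only [map_add, map_mul, map_pow, map_intCast, _root_.map_zero]
      rw [← he, hy]
      ring
  -- P + σP is a 2-torsion point fixed by σ, so it vanishes. Then σP = -P = P, and the same argument
  -- applies to P.
  have h1 : P + Point.map (W' := (cubicModel a b c).toAffine) σ P = 0 := by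
    refine key _ ?_ ?_
    · rw [add_add_add_comm, hP, ← map_add, hP, _root_.map_zero, add_zero]
    · rw [map_add, map_map_of_involutive _ hσ2, add_comm]
  refine key P hP ?_
  rw [eq_neg_of_add_eq_zero_right h1, neg_eq_of_add_eq_zero_right hP]

end Quadratic

theorem isElliptic_cubicModel {a b c : ℤ}
    (h : a ^ 2 * b ^ 2 - 4 * b ^ 3 - 4 * a ^ 3 * c - 27 * c ^ 2 + 18 * a * b * c ≠ 0) :
    (cubicModel a b c).IsElliptic := by
  refine ⟨isUnit_iff_ne_zero.mpr ?_⟩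
  have h1 : (cubicModel a b c).Δ = ((16 * (a ^ 2 * b ^ 2 - 4 * b ^ 3 - 4 * a ^ 3 * c - 27 * c ^ 2 +
      18 * a * b * c) : ℤ) : ℚ) := by
    simp only [WeierstrassCurve.Δ, WeierstrassCurve.b₂, WeierstrassCurve.b₄, WeierstrassCurve.b₆,
      WeierstrassCurve.b₈, cubicModel]
    push_cast
    ring
  rw [h1, Int.cast_ne_zero]
  exact mul_ne_zero (by norm_num) h

/-! ### Integral points and full two-torsion -/

section IntPoint

variable {a b c : ℤ} [hE : (cubicModel a b c).IsElliptic] (K : Type*) [Field K] [DecidableEq K]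
  [Algebra ℚ K]

/-- The point of `y² = x³ + a x² + b x + c` with given integral coordinates. -/
def intPoint (x y : ℤ) (h : y ^ 2 = x ^ 3 + a * x ^ 2 + b * x + c) :
    ((cubicModel a b c).baseChange K).toAffine.Point :=
  .some (x : K) (y : K) <| by
    have : ((cubicModel a b c).baseChange K).IsElliptic :=
      inferInstanceAs ((cubicModel a b c).map (algebraMap ℚ K)).IsElliptic
    refine (Affine.equation_iff_nonsingular (W := ((cubicModel a b c).baseChange K).toAffine)).mp ?_
    rw [(isCubicModel_baseChange a b c K).equation_iff]
    exact_mod_cast congrArg (Int.cast : ℤ → K) h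

omit [DecidableEq K] in
theorem intPoint_ne_zero {x y : ℤ} (h : y ^ 2 = x ^ 3 + a * x ^ 2 + b * x + c) :
    intPoint K x y h ≠ 0 :=
  Point.some_ne_zero _

omit [DecidableEq K] in
theorem abscissa_intPoint {x y : ℤ} (h : y ^ 2 = x ^ 3 + a * x ^ 2 + b * x + c) :
    (intPoint K x y h).abscissa = x :=
  rfl

theorem pointInclusion_intPoint {x y : ℤ} (h : y ^ 2 = x ^ 3 + a * x ^ 2 + b * x + c) :
    pointInclusion (cubicModel a b c) K (intPoint ℚ x y h) = intPoint K x y h := by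
  rw [intPoint, intPoint, pointInclusion, Point.baseChange, Point.map_some]
  simp only [map_intCast]

omit [DecidableEq K] in
theorem neg_intPoint {x y : ℤ} (h : y ^ 2 = x ^ 3 + a * x ^ 2 + b * x + c)
    (h' : (-y) ^ 2 = x ^ 3 + a * x ^ 2 + b * x + c) :
    -intPoint K x y h = intPoint K x (-y) h' := by
  rw [intPoint, intPoint, Point.neg_some]
  simp only [(isCubicModel_baseChange a b c K).negY_eq, Int.cast_neg]

theorem intPoint_add_self {x y x' y' : ℤ} (h : y ^ 2 = x ^ 3 + a * x ^ 2 + b * x + c)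
    (h' : y' ^ 2 = x' ^ 3 + a * x' ^ 2 + b * x' + c) (hy : y ≠ 0) (l : ℤ)
    (hl : l * (2 * y) = 3 * x ^ 2 + 2 * a * x + b) (hx' : x' = l ^ 2 - a - 2 * x)
    (hy' : y' = -(l * (x' - x) + y)) :
    intPoint K x y h + intPoint K x y h = intPoint K x' y' h' := by
  have : CharZero K := algebraRat.charZero K
  refine (isCubicModel_baseChange a b c K).add_self_some _ ?_ (l : K) ?_ ?_ ?_
  · exact mul_ne_zero two_ne_zero (Int.cast_ne_zero.mpr hy)
  · exact_mod_cast congrArg (Int.cast : ℤ → K) hl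
  · exact_mod_cast congrArg (Int.cast : ℤ → K) hx'
  · exact_mod_cast congrArg (Int.cast : ℤ → K) hy'

theorem intPoint_add_self_of_eq_zero {x : ℤ} (h : 0 ^ 2 = x ^ 3 + a * x ^ 2 + b * x + c) :
    intPoint K x 0 h + intPoint K x 0 h = 0 := by
  refine ((isCubicModel_baseChange a b c K).add_self_eq_zero_iff _).mpr ?_
  simp

theorem intPoint_add {x₁ y₁ x₂ y₂ x' y' : ℤ} (h₁ : y₁ ^ 2 = x₁ ^ 3 + a * x₁ ^ 2 + b * x₁ + c)
    (h₂ : y₂ ^ 2 = x₂ ^ 3 + a * x₂ ^ 2 + b * x₂ + c)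
    (h' : y' ^ 2 = x' ^ 3 + a * x' ^ 2 + b * x' + c) (hx : x₁ ≠ x₂) (l : ℤ)
    (hl : l * (x₁ - x₂) = y₁ - y₂) (hx' : x' = l ^ 2 - a - x₁ - x₂)
    (hy' : y' = -(l * (x' - x₁) + y₁)) :
    intPoint K x₁ y₁ h₁ + intPoint K x₂ y₂ h₂ = intPoint K x' y' h' := by
  have : CharZero K := algebraRat.charZero K
  refine (isCubicModel_baseChange a b c K).add_some_some _ ?_ (l : K) ?_ ?_ ?_
  · exact fun H ↦ hx (Int.cast_injective H)
  · exact_mod_cast congrArg (Int.cast : ℤ → K) hl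
  · exact_mod_cast congrArg (Int.cast : ℤ → K) hx'
  · exact_mod_cast congrArg (Int.cast : ℤ → K) hy'

variable {K}

theorem isRatTorsion_intPoint {x y : ℤ} (h : y ^ 2 = x ^ 3 + a * x ^ 2 + b * x + c) {n p : ℕ}
    (hn : Odd n) (hnp : n.Coprime p) (hnP : n • intPoint K x y h = 0) :
    IsRatTorsion p (intPoint K x y h) :=
  ⟨intPoint_ne_zero K h, ⟨x, by rw [abscissa_intPoint, map_intCast]⟩, n, hn, hnp, hnP⟩

/-- A point on a curve with full rational two-torsion `e₁, e₂, e₃` is not divisible by two over any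
quadratic field if `x - e₁` and `x - e₂` are independent modulo squares. -/
theorem add_self_ne_intPoint (hK : Module.finrank ℚ K = 2) {e₁ e₂ e₃ : ℤ}
    (ha : a = -(e₁ + e₂ + e₃)) (hb : b = e₁ * e₂ + e₁ * e₃ + e₂ * e₃) (hc : c = -(e₁ * e₂ * e₃))
    {x y : ℤ} (h : y ^ 2 = x ^ 3 + a * x ^ 2 + b * x + c) (h1 : ¬ IsSquare (x - e₁))
    (h2 : ¬ IsSquare (x - e₂)) (h3 : ¬ IsSquare ((x - e₁) * (x - e₂)))
    (P : ((cubicModel a b c).baseChange K).toAffine.Point) : P + P ≠ intPoint K x y h := by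
  intro H
  have hV := isCubicModel_baseChange a b c K
  have hPP : P + P ≠ 0 := H ▸ intPoint_ne_zero K h
  have hP : P ≠ 0 := by
    rintro rfl
    exact hPP (add_zero 0)
  have ha' : (a : K) = -(e₁ + e₂ + e₃) := by exact_mod_cast congrArg (Int.cast : ℤ → K) ha
  have hb' : (b : K) = e₁ * e₂ + e₁ * e₃ + e₂ * e₃ := by
    exact_mod_cast congrArg (Int.cast : ℤ → K) hb
  have hc' : (c : K) = -(e₁ * e₂ * e₃) := by exact_mod_cast congrArg (Int.cast : ℤ → K) hc
  refine not_isSquare_and_isSquare hK h1 h2 h3 ⟨?_, ?_⟩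
  · have := hV.isSquare_of_add_self ha' hb' hc' hP hPP
    rw [H, abscissa_intPoint] at this
    exact_mod_cast this
  · have := hV.isSquare_of_add_self (e₁ := (e₂ : K)) (e₂ := e₁) (e₃ := e₃) (by rw [ha']; ring)
      (by rw [hb']; ring) (by rw [hc']; ring) hP hPP
    rw [H, abscissa_intPoint] at this
    exact_mod_cast this

/-- The two-torsion points on a curve with full rational two-torsion. -/
theorem eq_intPoint_of_add_self_eq_zero {e₁ e₂ e₃ : ℤ}
    (ha : a = -(e₁ + e₂ + e₃)) (hb : b = e₁ * e₂ + e₁ * e₃ + e₂ * e₃) (hc : c = -(e₁ * e₂ * e₃))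
    (P : ((cubicModel a b c).baseChange K).toAffine.Point) (hP : P + P = 0) :
    P = 0 ∨ ∃ e h, (e = e₁ ∨ e = e₂ ∨ e = e₃) ∧ P = intPoint K e 0 h := by
  have : CharZero K := algebraRat.charZero K
  have hV := isCubicModel_baseChange a b c K
  cases P with
  | zero => exact Or.inl rfl
  | some x y h =>
    right
    have hy : y = 0 := by simpa using (hV.add_self_eq_zero_iff h).mp hP
    have he := (hV.equation_iff x y).mp h.1
    rw [hy, ha, hb, hc] at he
    push_cast at he
    have hprod : (x - e₁) * (x - e₂) * (x - e₃) = 0 := by linear_combination -he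
    have hsome : ∀ e : ℤ, (e = e₁ ∨ e = e₂ ∨ e = e₃) → x = e →
        ∃ e h', (e = e₁ ∨ e = e₂ ∨ e = e₃) ∧ Point.some x y h = intPoint K e 0 h' := by
      intro e hmem hx
      refine ⟨e, ?_, hmem, ?_⟩
      · rw [ha, hb, hc]
        rcases hmem with rfl | rfl | rfl <;> ring
      · simp only [intPoint, hx, hy, Int.cast_zero]
    rcases mul_eq_zero.mp hprod with h1 | h1
    · rcases mul_eq_zero.mp h1 with h1 | h1
      · exact hsome e₁ (by simp) (sub_eq_zero.mp h1)
      · exact hsome e₂ (by simp) (sub_eq_zero.mp h1)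
    · exact hsome e₃ (by simp) (sub_eq_zero.mp h1)

end IntPoint

/-! ### Rational roots of integral polynomials -/

/-- A monic integral cubic without roots modulo a prime has no rational roots. -/
theorem cubic_ne_zero {a b c : ℤ} (q : ℕ) [hq : Fact q.Prime]
    (h : ∀ r : ZMod q, r ^ 3 + a * r ^ 2 + b * r + c ≠ 0) (x : ℚ) :
    x ^ 3 + a * x ^ 2 + b * x + c ≠ 0 := by
  intro hx
  have hd : (x.den : ℚ) ≠ 0 := Nat.cast_ne_zero.mpr x.den_ne_zero
  have h1 : x.num ^ 3 + a * x.num ^ 2 * x.den + b * x.num * (x.den : ℤ) ^ 2 +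
      c * (x.den : ℤ) ^ 3 = 0 := by
    have : ((x.num ^ 3 + a * x.num ^ 2 * x.den + b * x.num * (x.den : ℤ) ^ 2 +
      c * (x.den : ℤ) ^ 3 : ℤ) : ℚ) = 0 := by
      push_cast
      rw [← Rat.mul_den_eq_num x]
      linear_combination (x.den : ℚ) ^ 3 * hx
    exact_mod_cast this
  have h2 := congrArg (Int.cast : ℤ → ZMod q) h1
  push_cast at h2
  by_cases hden : (x.den : ZMod q) = 0
  · rw [hden] at h2
    have hnum : (x.num : ZMod q) = 0 := by
      refine pow_eq_zero_iff three_ne_zero |>.mp ?_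
      linear_combination h2
    have d1 : (q : ℤ) ∣ x.num := (ZMod.intCast_zmod_eq_zero_iff_dvd _ q).mp hnum
    have d2 : q ∣ x.den := (ZMod.natCast_eq_zero_iff _ q).mp hden
    have d3 := Nat.dvd_gcd (Int.natCast_dvd.mp d1) d2
    rw [x.reduced] at d3
    exact hq.out.one_lt.ne' (Nat.dvd_one.mp d3)
  · refine h ((x.num : ZMod q) / x.den) ?_
    field_simp
    linear_combination h2

/-- An integral quartic without roots modulo a prime not dividing its leading coefficient has no
rational roots. -/
theorem quartic_ne_zero {a₄ a₃ a₂ a₁ a₀ : ℤ} (q : ℕ) [hq : Fact q.Prime]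
    (ha : (a₄ : ZMod q) ≠ 0)
    (h : ∀ r : ZMod q, a₄ * r ^ 4 + a₃ * r ^ 3 + a₂ * r ^ 2 + a₁ * r + a₀ ≠ 0) (x : ℚ) :
    a₄ * x ^ 4 + a₃ * x ^ 3 + a₂ * x ^ 2 + a₁ * x + a₀ ≠ 0 := by
  intro hx
  have hd : (x.den : ℚ) ≠ 0 := Nat.cast_ne_zero.mpr x.den_ne_zero
  have h1 : a₄ * x.num ^ 4 + a₃ * x.num ^ 3 * x.den + a₂ * x.num ^ 2 * (x.den : ℤ) ^ 2 +
      a₁ * x.num * (x.den : ℤ) ^ 3 + a₀ * (x.den : ℤ) ^ 4 = 0 := by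
    have : ((a₄ * x.num ^ 4 + a₃ * x.num ^ 3 * x.den + a₂ * x.num ^ 2 * (x.den : ℤ) ^ 2 +
      a₁ * x.num * (x.den : ℤ) ^ 3 + a₀ * (x.den : ℤ) ^ 4 : ℤ) : ℚ) = 0 := by
      push_cast
      rw [← Rat.mul_den_eq_num x]
      linear_combination (x.den : ℚ) ^ 4 * hx
    exact_mod_cast this
  have h2 := congrArg (Int.cast : ℤ → ZMod q) h1
  push_cast at h2
  by_cases hden : (x.den : ZMod q) = 0
  · rw [hden] at h2
    have hnum : (x.num : ZMod q) = 0 := by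
      refine pow_eq_zero_iff four_ne_zero |>.mp ((mul_eq_zero.mp ?_).resolve_left ha)
      linear_combination h2
    have d1 : (q : ℤ) ∣ x.num := (ZMod.intCast_zmod_eq_zero_iff_dvd _ q).mp hnum
    have d2 : q ∣ x.den := (ZMod.natCast_eq_zero_iff _ q).mp hden
    have d3 := Nat.dvd_gcd (Int.natCast_dvd.mp d1) d2
    rw [x.reduced] at d3
    exact hq.out.one_lt.ne' (Nat.dvd_one.mp d3)
  · refine h ((x.num : ZMod q) / x.den) ?_
    field_simp
    linear_combination h2

/-! ### Criteria for a curve to realize a group -/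

/-- `G` is the rational torsion subgroup of an elliptic curve over `ℚ` whose torsion does not grow
in any quadratic extension. -/
def IsStableTorsionGroup.{u, v} (G : Type v) [AddCommGroup G] : Prop :=
  ∃ E : WeierstrassCurve ℚ, E.IsElliptic ∧ Nonempty (G ≃+ torsionPoints E ℚ) ∧
    ∀ (K : Type u) [Field K] [DecidableEq K] [NumberField K], Module.finrank ℚ K = 2 →
      (torsionPoints E ℚ).map (pointInclusion E K) = torsionPoints E K

-- The field ℚ(i) serves to transfer the torsion bound over quadratic fields back to ℚ.
open Polynomial in
theorem exists_quadratic_extension :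
    ∃ (K : Type) (_ : Field K) (_ : Algebra ℚ K), Module.finrank ℚ K = 2 := by
  have := Fact.mk (cyclotomic.irreducible_rat four_pos)
  refine ⟨AdjoinRoot (cyclotomic 4 ℚ), inferInstance, inferInstance, ?_⟩
  rw [(AdjoinRoot.powerBasis (cyclotomic_ne_zero 4 ℚ)).finrank, AdjoinRoot.powerBasis_dim,
    natDegree_cyclotomic]
  decide

/-- The group of rational torsion points, and the absence of growth in quadratic fields, for a curve
all of whose torsion points over quadratic fields lie in the image of a finite group. -/
theorem exists_curve_of_torsionPoints_le.{u, v, w} {G : Type v} [AddCommGroup G] {H : Type w}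
    [AddCommGroup H] [Finite H] (e : G ≃+ H) (E : WeierstrassCurve ℚ) (hE : E.IsElliptic)
    (φ : H →+ (E.baseChange ℚ).toAffine.Point) (hφ : Function.Injective φ)
    (hmax : ∀ (K : Type u) [Field K] [DecidableEq K] [Algebra ℚ K], Module.finrank ℚ K = 2 →
      torsionPoints E K ≤ φ.range.map (pointInclusion E K)) :
    IsStableTorsionGroup.{u} G := by
  have hmap : ∀ (K : Type u) [Field K] [DecidableEq K] [Algebra ℚ K],
      (torsionPoints E ℚ).map (pointInclusion E K) ≤ torsionPoints E K := by
    rintro K _ _ _ _ ⟨P, hP, rfl⟩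
    exact AddMonoidHom.isOfFinAddOrder _ hP
  have hrange : φ.range ≤ torsionPoints E ℚ := by
    rintro _ ⟨g, rfl⟩
    exact AddMonoidHom.isOfFinAddOrder _ (isOfFinAddOrder_of_finite g)
  have htors : torsionPoints E ℚ = φ.range := by
    refine le_antisymm (fun P hP ↦ ?_) hrange
    classical
    obtain ⟨K, _, _, hK⟩ := exists_quadratic_extension
    -- `ULift` moves the field to the universe in which the bound is assumed.
    obtain ⟨Q, hQ, hPQ⟩ := hmax (ULift.{u} K) (finrank_ulift.trans hK) (hmap _ ⟨P, hP, rfl⟩)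
    exact Point.map_injective _ hPQ ▸ hQ
  refine ⟨E, hE, ⟨(e.trans (AddMonoidHom.ofInjective hφ)).trans
    (AddEquiv.addSubgroupCongr htors.symm)⟩, fun K _ _ _ hK ↦ le_antisymm (hmap K) ?_⟩
  rw [htors]
  exact hmax K hK

section Reduction

variable {a b c : ℤ} [hE : (cubicModel a b c).IsElliptic] {K : Type*} [Field K] [DecidableEq K]
  [Algebra ℚ K]

/-- A criterion for torsion points of odd order to lie in a given subgroup, in terms of the
dynamics of duplication modulo a prime. -/
theorem mem_of_reduction {R : AddSubgroup ((cubicModel a b c).baseChange K).toAffine.Point}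
    (p : ℕ) [Fact p.Prime] (hp2 : p ≠ 2) (hgood : IsSeparableMod a b c p)
    {P : ((cubicModel a b c).baseChange K).toAffine.Point} (hP : IsRatTorsion p P)
    (hs : ∀ s : ℕ → ZMod p, (∀ i, IsDuplicate a b c (s i) (s (i + 1))) →
      ∃ i, (s (i + 1) = s i ∧ (3 • P = 0 → P ∈ R)) ∨
      ∃ (x y : ℤ) (h : y ^ 2 = x ^ 3 + a * x ^ 2 + b * x + c), s i = x ∧ intPoint K x y h ∈ R ∧
        ∃ n : ℕ, Odd n ∧ n.Coprime p ∧ n • intPoint K x y h = 0) : P ∈ R := by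
  have hV := isCubicModel_baseChange a b c K
  obtain ⟨red, hinj, hdbl, -, hint⟩ := hV.exists_reduction p hp2 hgood
  have hPi : ∀ i : ℕ, IsRatTorsion p (2 ^ i • P) := by
    intro i
    induction i with
    | zero => simpa using hP
    | succ i ih =>
      rw [pow_succ, mul_comm, mul_nsmul', two_nsmul]
      exact ih.add_self hV
  obtain ⟨i, hi⟩ := hs (fun i ↦ red (2 ^ i • P)) fun i ↦ by
    have := hdbl _ (hPi i)
    rwa [← two_nsmul, ← mul_nsmul', ← pow_succ'] at this
  -- Multiplication by 2 ^ i is invertible on the multiples of a point of odd order. This is used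
  -- for R, and for the zero subgroup to pass from 3 • (2 ^ i • P) = 0 to 3 • P = 0.
  have hmem : ∀ S : AddSubgroup ((cubicModel a b c).baseChange K).toAffine.Point, ∀ Q,
      (∃ n : ℕ, Odd n ∧ n • Q = 0) → 2 ^ i • Q ∈ S → Q ∈ S := by
    rintro S Q ⟨n, hn, hnQ⟩ hQ
    have hcop : IsCoprime ((2 ^ i : ℕ) : ℤ) (n : ℤ) :=
      Nat.isCoprime_iff_coprime.mpr (Nat.Coprime.pow_left i (Nat.coprime_two_left.mpr hn))
    obtain ⟨u, v, huv⟩ := hcop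
    have : Q = u • (2 ^ i • Q) := by
      have hv : v • (n : ℤ) • Q = 0 := by rw [natCast_zsmul, hnQ, zsmul_zero]
      rw [← natCast_zsmul, ← add_zero (u • _), ← hv, smul_smul, smul_smul, ← add_smul, huv,
        one_smul]
    rw [this]
    exact zsmul_mem hQ u
  obtain ⟨n, hn, -, hnP⟩ := hP.2.2
  rcases hi with ⟨h1, h3⟩ | ⟨x, y, h, hx, hR, n', hn', hnp', hn0⟩
  · refine h3 ?_
    have h3' : 3 • (2 ^ i • P) = 0 := by
      rcases hinj _ _ (hPi (i + 1)) (hPi i) h1 with h | h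
      · rw [pow_succ', mul_nsmul', two_nsmul, add_eq_left] at h
        exact absurd h (hPi i).1
      · rw [pow_succ', mul_nsmul', eq_neg_iff_add_eq_zero, ← succ_nsmul] at h
        exact h
    refine (AddSubgroup.mem_bot).mp (hmem ⊥ (3 • P) ⟨n, hn, ?_⟩ ?_)
    · rw [smul_comm, hnP, nsmul_zero]
    · rw [smul_comm, h3']
      exact zero_mem _
  · have hT : IsRatTorsion p (intPoint K x y h) := isRatTorsion_intPoint h hn' hnp' hn0
    have hred : red (2 ^ i • P) = red (intPoint K x y h) := by
      rw [hint _ hT x (abscissa_intPoint K h), ← hx]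
    refine hmem R P ⟨n, hn, hnP⟩ ?_
    rcases hinj _ _ (hPi i) hT hred with H | H
    · exact H ▸ hR
    · exact H ▸ neg_mem hR

theorem nsmul_intPoint_eq {x y x' y' : ℤ} {h : y ^ 2 = x ^ 3 + a * x ^ 2 + b * x + c}
    {h' : y' ^ 2 = x' ^ 3 + a * x' ^ 2 + b * x' + c} {k : ℕ}
    (hk : k • intPoint ℚ x y h = intPoint ℚ x' y' h') :
    k • intPoint K x y h = intPoint K x' y' h' := by
  rw [← pointInclusion_intPoint, ← map_nsmul, hk, pointInclusion_intPoint]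

theorem nsmul_intPoint_eq_zero {x y : ℤ} {h : y ^ 2 = x ^ 3 + a * x ^ 2 + b * x + c} {k : ℕ}
    (hk : k • intPoint ℚ x y h = 0) : k • intPoint K x y h = 0 := by
  rw [← pointInclusion_intPoint, ← map_nsmul, hk, map_zero]

omit hE in
/-- Torsion points of odd order with rational abscissa have order prime to three if the
`3`-division polynomial has no rational roots. -/
theorem isRatTorsion_three {P : ((cubicModel a b c).baseChange K).toAffine.Point}
    (hP : IsRatTorsion 1 P) (q : ℕ) [Fact q.Prime] (hq : (3 : ZMod q) ≠ 0)
    (h : ∀ r : ZMod q, 3 * r ^ 4 + 4 * a * r ^ 3 + 6 * b * r ^ 2 + 12 * c * r +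
      (4 * a * c - b ^ 2) ≠ 0) : IsRatTorsion 3 P ∧ 3 • P ≠ 0 := by
  have h3 := (isCubicModel_baseChange a b c K).abscissa_notMem_range_of_three_nsmul fun x ↦ by
    have := quartic_ne_zero (a₄ := 3) (a₃ := 4 * a) (a₂ := 6 * b) (a₁ := 12 * c)
      (a₀ := 4 * a * c - b ^ 2) q (by simpa using hq) (fun r ↦ by simpa using h r) x
    simpa using this
  exact ⟨(isCubicModel_baseChange a b c K).isRatTorsion_of_forall Nat.prime_three h3 hP,
    fun h ↦ h3 P hP.1 h hP.2.1⟩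

end Reduction

/-- Realization of odd cyclic groups. -/
theorem exists_curve_of_cyclic.{u, v} {G : Type v} [AddCommGroup G] {n : ℕ} (hn : Odd n)
    (e : G ≃+ ZMod n) {a b c : ℤ} [hE : (cubicModel a b c).IsElliptic]
    (hroot : ∀ x : ℚ, x ^ 3 + a * x ^ 2 + b * x + c ≠ 0)
    (P : ((cubicModel a b c).baseChange ℚ).toAffine.Point) (hP : addOrderOf P = n)
    (hodd : ∀ (K : Type u) [Field K] [DecidableEq K] [Algebra ℚ K], ∀ Q,
      IsRatTorsion 1 Q → Q ∈ AddSubgroup.zmultiples (pointInclusion (cubicModel a b c) K P)) :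
    IsStableTorsionGroup.{u} G := by
  have hcard : Nat.card (AddSubgroup.zmultiples P) = n := (Nat.card_zmultiples P).trans hP
  have : Finite (AddSubgroup.zmultiples P) := Nat.finite_of_card_ne_zero (hcard ▸ hn.pos.ne')
  subst hcard
  refine exists_curve_of_torsionPoints_le.{u}
    (e.trans (zmodAddCyclicAddEquiv (G := AddSubgroup.zmultiples P) inferInstance))
    (cubicModel a b c) hE (AddSubgroup.zmultiples P).subtype Subtype.val_injective ?_
  intro K _ _ _ hK
  rw [AddSubgroup.range_subtype, AddMonoidHom.map_zmultiples]
  refine torsionPoints_le _ hK ?_ (hodd K) (mem_of_add_self_mem ?_ ?_)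
  · rw [AddSubgroup.zmultiples_le]
    exact ⟨P, rfl⟩
  · intro Q hQ
    rw [eq_zero_of_add_self_eq_zero hK hroot hQ]
    exact zero_mem _
  · intro S hS
    obtain ⟨k, hk⟩ := hn
    -- In a group killed by 2k + 1, half of S is (k + 1)S.
    refine ⟨(k + 1) • S, nsmul_mem hS _, Or.inl ?_⟩
    have hS0 : (2 * k + 1) • S = 0 := by
      obtain ⟨z, rfl⟩ := hS
      have h0 : (2 * k + 1) • P = 0 := by rw [← hk, ← hP, addOrderOf_nsmul_eq_zero]
      change (2 * k + 1) • (z • pointInclusion (cubicModel a b c) K P) = 0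
      rw [smul_comm, ← map_nsmul, h0, map_zero, smul_zero]
    rw [← add_nsmul, show k + 1 + (k + 1) = 2 * k + 1 + 1 by ring, succ_nsmul, hS0, zero_add]

/-- The homomorphism from `ZMod 2 × ZMod n` given by two elements annihilated by `2` and `n`. -/
def zmodProdHom {A : Type*} [AddCommGroup A] (n : ℕ) (T P : A) (hT : T + T = 0) (hP : n • P = 0) :
    ZMod 2 × ZMod n →+ A :=
  (ZMod.lift 2 ⟨zmultiplesHom A T, by simpa [two_nsmul, two_zsmul] using hT⟩).coprod
    (ZMod.lift n ⟨zmultiplesHom A P, by simpa using hP⟩)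

section ZModProd

variable {A : Type*} [AddCommGroup A] {n : ℕ} {T P : A} {hT : T + T = 0} {hP : n • P = 0}

theorem zmodProdHom_intCast (i j : ℤ) :
    zmodProdHom n T P hT hP ((i : ZMod 2), (j : ZMod n)) = i • T + j • P := by
  simp [zmodProdHom]

theorem zmodProdHom_one_zero : zmodProdHom n T P hT hP (1, 0) = T := by
  simpa using zmodProdHom_intCast (hT := hT) (hP := hP) 1 0

theorem zmodProdHom_zero_one : zmodProdHom n T P hT hP (0, 1) = P := by
  simpa using zmodProdHom_intCast (hT := hT) (hP := hP) 0 1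

/-- A relation T = -jP forces 2jP = 0, so m divides j and T is 0 or mP. -/
theorem zmodProdHom_injective {m : ℕ} {hP : (2 * m) • P = 0} (hord : addOrderOf P = 2 * m)
    (hT0 : T ≠ 0) (hTP : T ≠ m • P) : Function.Injective (zmodProdHom (2 * m) T P hT hP) := by
  rw [injective_iff_map_eq_zero]
  rintro ⟨i, j⟩ h
  obtain ⟨j, rfl⟩ := ZMod.intCast_surjective j
  have hj0 : j • P = 0 → (j : ZMod (2 * m)) = 0 := fun hj ↦ by
    rw [ZMod.intCast_zmod_eq_zero_iff_dvd, ← hord]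
    exact addOrderOf_dvd_iff_zsmul_eq_zero.mpr hj
  have hi : i = 0 ∨ i = 1 := by clear h; revert i; decide
  rcases hi with rfl | rfl
  · have := zmodProdHom_intCast (hT := hT) (hP := hP) 0 j
    rw [Int.cast_zero, h, zero_zsmul, zero_add] at this
    rw [hj0 this.symm]
    rfl
  · exfalso
    have := zmodProdHom_intCast (hT := hT) (hP := hP) 1 j
    rw [Int.cast_one, h, one_zsmul] at this
    have hTj : T = -(j • P) := eq_neg_of_add_eq_zero_left this.symm
    have h2 : (2 * j) • P = 0 := by
      rw [two_mul, add_zsmul]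
      rw [hTj, ← neg_add, neg_eq_zero] at hT
      exact hT
    have hdvd := addOrderOf_dvd_iff_zsmul_eq_zero.mpr h2
    rw [hord] at hdvd
    push_cast at hdvd
    obtain ⟨k, rfl⟩ := Int.dvd_of_mul_dvd_mul_left two_ne_zero hdvd
    have hm2 : (m • P) + (m • P) = 0 := by rw [← add_nsmul, ← two_mul, hP]
    rw [mul_comm, mul_zsmul, natCast_zsmul] at hTj
    rcases Int.even_or_odd' k with ⟨l, rfl | rfl⟩
    · rw [mul_comm, mul_zsmul, two_zsmul, hm2, zsmul_zero, neg_zero] at hTj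
      exact hT0 hTj
    · rw [add_zsmul, mul_comm, mul_zsmul, two_zsmul, hm2, zsmul_zero, zero_add, one_zsmul,
        neg_eq_of_add_eq_zero_left hm2] at hTj
      exact hTP hTj

end ZModProd

/-- Realization of groups with full two-torsion. -/
theorem exists_curve_of_product.{u, v} {G : Type v} [AddCommGroup G] {m : ℕ} (hm : m ≠ 0)
    (e : G ≃+ ZMod 2 × ZMod (2 * m)) {a b c : ℤ} [hE : (cubicModel a b c).IsElliptic]
    {e₁ e₂ e₃ : ℤ} (ha : a = -(e₁ + e₂ + e₃)) (hb : b = e₁ * e₂ + e₁ * e₃ + e₂ * e₃)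
    (hc : c = -(e₁ * e₂ * e₃)) (h₁ : 0 ^ 2 = e₁ ^ 3 + a * e₁ ^ 2 + b * e₁ + c)
    (h₂ : 0 ^ 2 = e₂ ^ 3 + a * e₂ ^ 2 + b * e₂ + c) (h₃ : 0 ^ 2 = e₃ ^ 3 + a * e₃ ^ 2 + b * e₃ + c)
    (h₁₂ : e₁ ≠ e₂) {x y x' y' : ℤ} (h : y ^ 2 = x ^ 3 + a * x ^ 2 + b * x + c)
    (h' : y' ^ 2 = x' ^ 3 + a * x' ^ 2 + b * x' + c)
    (hmP : m • intPoint ℚ x y h = intPoint ℚ e₂ 0 h₂)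
    (hord : addOrderOf (intPoint ℚ x y h) = 2 * m)
    (hTP : intPoint ℚ e₁ 0 h₁ + intPoint ℚ x y h = intPoint ℚ x' y' h')
    (sq₁ : ¬ IsSquare (e₁ - e₂) ∧ ¬ IsSquare (e₁ - e₃) ∧ ¬ IsSquare ((e₁ - e₂) * (e₁ - e₃)))
    (sq₂ : ¬ IsSquare (x - e₁) ∧ ¬ IsSquare (x - e₃) ∧ ¬ IsSquare ((x - e₁) * (x - e₃)))
    (sq₃ : ¬ IsSquare (x' - e₁) ∧ ¬ IsSquare (x' - e₂) ∧ ¬ IsSquare ((x' - e₁) * (x' - e₂)))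
    (hodd : ∀ (K : Type u) [Field K] [DecidableEq K] [Algebra ℚ K], ∀ Q,
      IsRatTorsion 1 Q → Q ∈ AddSubgroup.zmultiples (intPoint K x y h)) :
    IsStableTorsionGroup.{u} G := by
  have : NeZero (2 * m) := ⟨by omega⟩
  have hT2 := intPoint_add_self_of_eq_zero ℚ h₁
  have hP2 : (2 * m) • intPoint ℚ x y h = 0 := by rw [← hord, addOrderOf_nsmul_eq_zero]
  set φ := zmodProdHom (2 * m) _ _ hT2 hP2 with hφ
  have hTe : φ (1, 0) = intPoint ℚ e₁ 0 h₁ := zmodProdHom_one_zero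
  have hPe : φ (0, 1) = intPoint ℚ x y h := zmodProdHom_zero_one
  have hTPe : φ (1, 1) = intPoint ℚ x' y' h' := by
    rw [← hTP, ← hTe, ← hPe, ← map_add]
    simp
  refine exists_curve_of_torsionPoints_le.{u} e (cubicModel a b c) hE φ
    (zmodProdHom_injective hord (intPoint_ne_zero ℚ h₁) ?_) ?_
  · rw [hmP]
    intro H
    have := congrArg Point.abscissa H
    rw [abscissa_intPoint, abscissa_intPoint] at this
    exact h₁₂ (Int.cast_injective this)
  intro K _ _ _ hK
  have hmem : ∀ g, pointInclusion (cubicModel a b c) K (φ g) ∈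
      φ.range.map (pointInclusion (cubicModel a b c) K) := fun g ↦ ⟨_, ⟨g, rfl⟩, rfl⟩
  refine torsionPoints_le _ hK ?_ (fun Q hQ ↦ ?_) (mem_of_add_self_mem ?_ ?_)
  · rintro _ ⟨Q, -, rfl⟩
    exact ⟨Q, rfl⟩
  · refine (AddSubgroup.zmultiples_le.mpr ?_) (hodd K Q hQ)
    rw [← pointInclusion_intPoint, ← hPe]
    exact hmem _
  · intro Q hQ
    have m₁ : intPoint K e₁ 0 h₁ ∈ φ.range.map (pointInclusion (cubicModel a b c) K) := by
      rw [← pointInclusion_intPoint, ← hTe]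
      exact hmem _
    have m₂ : intPoint K e₂ 0 h₂ ∈ φ.range.map (pointInclusion (cubicModel a b c) K) := by
      rw [← pointInclusion_intPoint, ← hmP, ← hPe, ← map_nsmul]
      exact hmem _
    have m₃ : intPoint K e₃ 0 h₃ ∈ φ.range.map (pointInclusion (cubicModel a b c) K) := by
      rw [← intPoint_add K h₁ h₂ h₃ h₁₂ 0 (by ring) (by rw [ha]; ring) (by ring)]
      exact add_mem m₁ m₂
    rcases eq_intPoint_of_add_self_eq_zero ha hb hc Q hQ with rfl | ⟨e, he, rfl | rfl | rfl, rfl⟩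
    · exact zero_mem _
    · exact m₁
    · exact m₂
    · exact m₃
  · rintro _ ⟨_, ⟨⟨i, j⟩, rfl⟩, rfl⟩
    obtain ⟨j, rfl⟩ := ZMod.intCast_surjective j
    -- The classes modulo doubles are represented by 0, T, P and T + P.
    have hij : ∃ h : ZMod 2 × ZMod (2 * m), (i, (j : ZMod (2 * m))) - (h + h) = 0 ∨
        (i, (j : ZMod (2 * m))) - (h + h) = (1, 0) ∨ (i, (j : ZMod (2 * m))) - (h + h) = (0, 1) ∨
        (i, (j : ZMod (2 * m))) - (h + h) = (1, 1) := by
      have hi : i = 0 ∨ i = 1 := by revert i; decide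
      obtain ⟨l, rfl | rfl⟩ := Int.even_or_odd' j
      · refine ⟨(0, (l : ZMod (2 * m))), ?_⟩
        rcases hi with rfl | rfl
        · left; ext <;> simp [two_mul]
        · right; left; ext <;> simp [two_mul]
      · refine ⟨(0, (l : ZMod (2 * m))), ?_⟩
        rcases hi with rfl | rfl
        · right; right; left; ext <;> simp [two_mul]
        · right; right; right; ext <;> simp [two_mul]
    obtain ⟨g, hg⟩ := hij
    refine ⟨_, hmem g, ?_⟩
    rw [← map_add, ← map_add, ← map_sub, ← map_sub]
    rcases hg with hg | hg | hg | hg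
    · left
      rw [sub_eq_zero.mp hg]
    · right
      rw [hg, hTe, pointInclusion_intPoint]
      -- At T = (e₁, 0) the difference with e₁ is zero, a square, so the roots are permuted to test
      -- e₂ and e₃.
      exact add_self_ne_intPoint hK (e₁ := e₂) (e₂ := e₃) (e₃ := e₁) (by rw [ha]; ring)
        (by rw [hb]; ring) (by rw [hc]; ring) h₁ sq₁.1 sq₁.2.1 sq₁.2.2
    · right
      rw [hg, hPe, pointInclusion_intPoint]
      exact add_self_ne_intPoint hK (e₁ := e₁) (e₂ := e₃) (e₃ := e₂) (by rw [ha]; ring)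
        (by rw [hb]; ring) (by rw [hc]; ring) h sq₂.1 sq₂.2.1 sq₂.2.2
    · right
      rw [hg, hTPe, pointInclusion_intPoint]
      exact add_self_ne_intPoint hK ha hb hc h' sq₃.1 sq₃.2.1 sq₃.2.2

/-! ### The nine curves -/

instance : Fact (Nat.Prime 5) :=
  ⟨by norm_num⟩

instance : Fact (Nat.Prime 7) :=
  ⟨by norm_num⟩

instance : Fact (Nat.Prime 11) :=
  ⟨by norm_num⟩

instance : Fact (Nat.Prime 13) :=
  ⟨by norm_num⟩

/-- The curve `y² = x³ + x - 1`. -/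
theorem isStableTorsionGroup_one.{u, v} {G : Type v} [AddCommGroup G] (e : G ≃+ ZMod 1) :
    IsStableTorsionGroup.{u} G := by
  have hE : (cubicModel 0 1 (-1)).IsElliptic := isElliptic_cubicModel (by norm_num)
  refine exists_curve_of_cyclic.{u} (hE := hE) odd_one e (cubic_ne_zero 2 (by decide +kernel)) 0
    addOrderOf_zero fun K _ _ _ Q hQ ↦ ?_
  obtain ⟨hQ3, -⟩ := isRatTorsion_three hQ 7 (by decide) (by decide +kernel)
  refine mem_of_reduction 3 (by norm_num) (by decide +kernel) hQ3 fun s hs ↦ ?_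
  -- Every orbit modulo 3 runs into a root of the cubic before three duplications are complete.
  have key : ∀ r₀ r₁ : ZMod 3, IsDuplicate 0 1 (-1) r₀ r₁ → ∀ r₂, IsDuplicate 0 1 (-1) r₁ r₂ →
      ∀ r₃, ¬ IsDuplicate 0 1 (-1) r₂ r₃ := by
    decide +kernel
  exact absurd (hs 2) (key _ _ (hs 0) _ (hs 1) _)

/-- The curve `y² = x³ + x² - 4 x + 4`. -/
theorem isStableTorsionGroup_three.{u, v} {G : Type v} [AddCommGroup G] (e : G ≃+ ZMod 3) :
    IsStableTorsionGroup.{u} G := by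
  have hE : (cubicModel 1 (-4) 4).IsElliptic := isElliptic_cubicModel (by norm_num)
  have h₁ : (2 : ℤ) ^ 2 = 0 ^ 3 + 1 * 0 ^ 2 + -4 * 0 + 4 := by norm_num
  have h₂ : (-2 : ℤ) ^ 2 = 0 ^ 3 + 1 * 0 ^ 2 + -4 * 0 + 4 := by norm_num
  have hP : 3 • intPoint ℚ 0 2 h₁ = 0 := by
    rw [succ_nsmul, two_nsmul, intPoint_add_self ℚ h₁ h₂ (by norm_num) (-1) (by norm_num)
      (by norm_num) (by norm_num), ← neg_intPoint ℚ h₁, neg_add_cancel]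
  refine exists_curve_of_cyclic.{u} (by decide) e (cubic_ne_zero 3 (by decide +kernel))
    (intPoint ℚ 0 2 h₁) (addOrderOf_eq_prime hP (intPoint_ne_zero ℚ h₁)) fun K _ _ _ Q hQ ↦ ?_
  rw [pointInclusion_intPoint]
  have hV := isCubicModel_baseChange 1 (-4) 4 K
  -- Reduction modulo 3 would not control the known point of order 3, so 7 is used. Order 7 is
  -- excluded modulo 13, as 7 = 2³ - 1.
  have hQ7 : IsRatTorsion 7 Q := by
    refine hV.isRatTorsion_of_forall (by norm_num) (hV.abscissa_notMem_range_of_nsmul 13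
      (by norm_num) (by decide +kernel) (k := 3) (by norm_num) (by norm_num) (by norm_num)
      (by norm_num) fun s hs h ↦ ?_) hQ
    have key : ∀ r₀ r₁ : ZMod 13, IsDuplicate 1 (-4) 4 r₀ r₁ → ∀ r₂, IsDuplicate 1 (-4) 4 r₁ r₂ →
      IsDuplicate 1 (-4) 4 r₂ r₀ → r₁ = r₀ := by decide +kernel
    exact key _ _ (hs 0) _ (hs 1) (h ▸ hs 2)
  refine mem_of_reduction 7 (by norm_num) (by decide +kernel) hQ7 fun s hs ↦ ?_
  have key : ∀ r₀ r₁ : ZMod 7, IsDuplicate 1 (-4) 4 r₀ r₁ → ∀ r₂, IsDuplicate 1 (-4) 4 r₁ r₂ →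
      r₂ = (0 : ℤ) := by decide +kernel
  exact ⟨2, .inr ⟨0, 2, h₁, key _ _ (hs 0) _ (hs 1), AddSubgroup.mem_zmultiples _, 3, by decide,
    by norm_num, nsmul_intPoint_eq_zero hP⟩⟩

/-- The curve `y² = x³ - 4 x² + 16`. -/
theorem isStableTorsionGroup_five.{u, v} {G : Type v} [AddCommGroup G] (e : G ≃+ ZMod 5) :
    IsStableTorsionGroup.{u} G := by
  have hE : (cubicModel (-4) 0 16).IsElliptic := isElliptic_cubicModel (by norm_num)
  have h₁ : (4 : ℤ) ^ 2 = 0 ^ 3 + -4 * 0 ^ 2 + 0 * 0 + 16 := by norm_num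
  have h₂ : (-4 : ℤ) ^ 2 = 4 ^ 3 + -4 * 4 ^ 2 + 0 * 4 + 16 := by norm_num
  have h₄ : (-4 : ℤ) ^ 2 = 0 ^ 3 + -4 * 0 ^ 2 + 0 * 0 + 16 := by norm_num
  have d₁ : 2 • intPoint ℚ 0 4 h₁ = intPoint ℚ 4 (-4) h₂ := by
    rw [two_nsmul]
    exact intPoint_add_self ℚ h₁ h₂ (by norm_num) 0 (by norm_num) (by norm_num) (by norm_num)
  have d₂ : 2 • intPoint ℚ 4 (-4) h₂ = intPoint ℚ 0 (-4) h₄ := by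
    rw [two_nsmul]
    exact intPoint_add_self ℚ h₂ h₄ (by norm_num) (-2) (by norm_num) (by norm_num) (by norm_num)
  have hP : 5 • intPoint ℚ 0 4 h₁ = 0 := by
    rw [show 5 = 2 * 2 + 1 from rfl, succ_nsmul, mul_nsmul, d₁, d₂, ← neg_intPoint ℚ h₁,
      neg_add_cancel]
  refine exists_curve_of_cyclic.{u} (by decide) e (cubic_ne_zero 3 (by decide +kernel))
    (intPoint ℚ 0 4 h₁) (addOrderOf_eq_prime hP (intPoint_ne_zero ℚ h₁)) fun K _ _ _ Q hQ ↦ ?_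
  rw [pointInclusion_intPoint]
  obtain ⟨hQ3, h3⟩ := isRatTorsion_three hQ 5 (by decide) (by decide +kernel)
  refine mem_of_reduction 3 (by norm_num) (by decide +kernel) hQ3 fun s hs ↦ ⟨0, ?_⟩
  -- The residues 0 and 1 come from P and 2P; the remaining one can only duplicate to itself, and
  -- order 3 has been excluded.
  have key : ∀ r₀ r₁ : ZMod 3, IsDuplicate (-4) 0 16 r₀ r₁ → r₁ = r₀ ∨ r₀ = (0 : ℤ) ∨
      r₀ = (4 : ℤ) := by decide +kernel
  have hP' := nsmul_intPoint_eq_zero (K := K) hP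
  rcases key _ _ (hs 0) with h | h | h
  · exact .inl ⟨h, (absurd · h3)⟩
  · exact .inr ⟨0, 4, h₁, h, AddSubgroup.mem_zmultiples _, 5, by decide, by norm_num, hP'⟩
  · refine .inr ⟨4, -4, h₂, h, ?_, 5, by decide, by norm_num, ?_⟩
    · rw [← nsmul_intPoint_eq d₁]
      exact AddSubgroup.nsmul_mem_zmultiples _ _
    · rw [← nsmul_intPoint_eq d₁, smul_comm, hP', nsmul_zero]

/-- The curve `y² = x³ - 3 x² - 40 x + 208`. -/
theorem isStableTorsionGroup_seven.{u, v} {G : Type v} [AddCommGroup G] (e : G ≃+ ZMod 7) :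
    IsStableTorsionGroup.{u} G := by
  have hE : (cubicModel (-3) (-40) 208).IsElliptic := isElliptic_cubicModel (by norm_num)
  have h₁ : (16 : ℤ) ^ 2 = (-4) ^ 3 + -3 * (-4) ^ 2 + -40 * (-4) + 208 := by norm_num
  have h₂ : (-32 : ℤ) ^ 2 = 12 ^ 3 + -3 * 12 ^ 2 + -40 * 12 + 208 := by norm_num
  have h₄ : (-8 : ℤ) ^ 2 = 4 ^ 3 + -3 * 4 ^ 2 + -40 * 4 + 208 := by norm_num
  have d₁ : 2 • intPoint ℚ (-4) 16 h₁ = intPoint ℚ 12 (-32) h₂ := by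
    rw [two_nsmul]
    exact intPoint_add_self ℚ h₁ h₂ (by norm_num) 1 (by norm_num) (by norm_num) (by norm_num)
  have d₂ : 2 • intPoint ℚ 12 (-32) h₂ = intPoint ℚ 4 (-8) h₄ := by
    rw [two_nsmul]
    exact intPoint_add_self ℚ h₂ h₄ (by norm_num) (-5) (by norm_num) (by norm_num) (by norm_num)
  have d₄ : 2 • intPoint ℚ 4 (-8) h₄ = intPoint ℚ (-4) 16 h₁ := by
    rw [two_nsmul]
    exact intPoint_add_self ℚ h₄ h₁ (by norm_num) 1 (by norm_num) (by norm_num) (by norm_num)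
  have hP : 7 • intPoint ℚ (-4) 16 h₁ = 0 := by
    rw [← add_eq_right (b := intPoint ℚ (-4) 16 h₁), ← succ_nsmul,
      show 7 + 1 = 2 * 2 * 2 from rfl, mul_nsmul, mul_nsmul, d₁, d₂, d₄]
  refine exists_curve_of_cyclic.{u} (by decide) e (cubic_ne_zero 3 (by decide +kernel))
    (intPoint ℚ (-4) 16 h₁) (addOrderOf_eq_prime hP (intPoint_ne_zero ℚ h₁)) fun K _ _ _ Q hQ ↦ ?_
  rw [pointInclusion_intPoint]
  obtain ⟨hQ3, -⟩ := isRatTorsion_three hQ 5 (by decide) (by decide +kernel)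
  refine mem_of_reduction 3 (by norm_num) (by decide +kernel) hQ3 fun s hs ↦ ⟨0, .inr ?_⟩
  -- The abscissas of P, 2P and 4P exhaust `ZMod 3`.
  have key : ∀ r : ZMod 3, r = (-4 : ℤ) ∨ r = (12 : ℤ) ∨ r = (4 : ℤ) := by decide +kernel
  have hP' := nsmul_intPoint_eq_zero (K := K) hP
  rcases key (s 0) with h | h | h
  · exact ⟨-4, 16, h₁, h, AddSubgroup.mem_zmultiples _, 7, by decide, by norm_num, hP'⟩
  · refine ⟨12, -32, h₂, h, ?_, 7, by decide, by norm_num, ?_⟩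
    · rw [← nsmul_intPoint_eq d₁]
      exact AddSubgroup.nsmul_mem_zmultiples _ _
    · rw [← nsmul_intPoint_eq d₁, smul_comm, hP', nsmul_zero]
  · refine ⟨4, -8, h₄, h, ?_, 7, by decide, by norm_num, ?_⟩
    · rw [← nsmul_intPoint_eq d₂, ← nsmul_intPoint_eq d₁]
      exact nsmul_mem (AddSubgroup.nsmul_mem_zmultiples _ _) _
    · rw [← nsmul_intPoint_eq d₂, ← nsmul_intPoint_eq d₁, smul_comm, smul_comm 7 2, hP',
        nsmul_zero, nsmul_zero]

/-- The curve `y² = x³ - 3 x² - 216 x + 1872`. -/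
theorem isStableTorsionGroup_nine.{u, v} {G : Type v} [AddCommGroup G] (e : G ≃+ ZMod 9) :
    IsStableTorsionGroup.{u} G := by
  have hE : (cubicModel (-3) (-216) 1872).IsElliptic := isElliptic_cubicModel (by norm_num)
  have h₁ : (192 : ℤ) ^ 2 = 36 ^ 3 + -3 * 36 ^ 2 + -216 * 36 + 1872 := by norm_num
  have h₂ : (24 : ℤ) ^ 2 = 12 ^ 3 + -3 * 12 ^ 2 + -216 * 12 + 1872 := by norm_num
  have h₃ : (32 : ℤ) ^ 2 = 4 ^ 3 + -3 * 4 ^ 2 + -216 * 4 + 1872 := by norm_num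
  have h₄ : (48 : ℤ) ^ 2 = (-12) ^ 3 + -3 * (-12) ^ 2 + -216 * (-12) + 1872 := by norm_num
  have h₈ : (-192 : ℤ) ^ 2 = 36 ^ 3 + -3 * 36 ^ 2 + -216 * 36 + 1872 := by norm_num
  have d₁ : 2 • intPoint ℚ 36 192 h₁ = intPoint ℚ 12 24 h₂ := by
    rw [two_nsmul]
    exact intPoint_add_self ℚ h₁ h₂ (by norm_num) 9 (by norm_num) (by norm_num) (by norm_num)
  have d₂ : 2 • intPoint ℚ 12 24 h₂ = intPoint ℚ (-12) 48 h₄ := by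
    rw [two_nsmul]
    exact intPoint_add_self ℚ h₂ h₄ (by norm_num) 3 (by norm_num) (by norm_num) (by norm_num)
  have d₄ : 2 • intPoint ℚ (-12) 48 h₄ = intPoint ℚ 36 (-192) h₈ := by
    rw [two_nsmul]
    exact intPoint_add_self ℚ h₄ h₈ (by norm_num) 3 (by norm_num) (by norm_num) (by norm_num)
  have d₃ : 3 • intPoint ℚ 36 192 h₁ = intPoint ℚ 4 32 h₃ := by
    rw [succ_nsmul, d₁]
    exact intPoint_add ℚ h₂ h₁ h₃ (by norm_num) 7 (by norm_num) (by norm_num) (by norm_num)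
  have hP : 9 • intPoint ℚ 36 192 h₁ = 0 := by
    rw [show 9 = 2 * 2 * 2 + 1 from rfl, succ_nsmul, mul_nsmul, mul_nsmul, d₁, d₂, d₄,
      ← neg_intPoint ℚ h₁, neg_add_cancel]
  have hord : addOrderOf (intPoint ℚ 36 192 h₁) = 9 := by
    refine addOrderOf_eq_prime_pow (p := 3) (n := 1) ?_ hP
    rw [pow_one, d₃]
    exact intPoint_ne_zero ℚ h₃
  refine exists_curve_of_cyclic.{u} (by decide) e (cubic_ne_zero 5 (by decide +kernel))
    (intPoint ℚ 36 192 h₁) hord fun K _ _ _ Q hQ ↦ ?_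
  rw [pointInclusion_intPoint]
  have hV := isCubicModel_baseChange (-3) (-216) 1872 K
  -- Order 5 is excluded modulo 7, as 5 = 2² + 1.
  have hQ5 : IsRatTorsion 5 Q := by
    refine hV.isRatTorsion_of_forall (by norm_num) (hV.abscissa_notMem_range_of_nsmul 7
      (by norm_num) (by decide +kernel) (k := 2) (by norm_num) (by norm_num) (by norm_num)
      (by norm_num) fun s hs h ↦ ?_) hQ
    have key : ∀ r₀ r₁ : ZMod 7, IsDuplicate (-3) (-216) 1872 r₀ r₁ →
      IsDuplicate (-3) (-216) 1872 r₁ r₀ → r₁ = r₀ := by decide +kernel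
    exact key _ _ (hs 0) (h ▸ hs 1)
  have h3 : 3 • Q = 0 → Q ∈ AddSubgroup.zmultiples (intPoint K 36 192 h₁) := by
    intro h
    obtain ⟨x, hx⟩ := hQ.2.1
    have hψ := hV.eq_zero_of_three_nsmul hQ.1 h hx.symm
    -- The 3-division polynomial has the root 4 = x(3P), and its cubic cofactor has no root modulo
    -- 7.
    have hψ' : 3 * (x - 4) * (x ^ 3 + (0 : ℤ) * x ^ 2 + (-432 : ℤ) * x + (5760 : ℤ)) = 0 := by
      refine (algebraMap ℚ K).injective ?_
      simp only [map_add, map_sub, map_mul, map_pow, map_intCast, map_ofNat, map_zero]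
      push_cast at hψ ⊢
      linear_combination hψ
    have h4 : x = 4 := by
      have := (mul_eq_zero.mp hψ').resolve_right (cubic_ne_zero 7 (by decide +kernel) x)
      linarith
    have hmem : intPoint K 4 32 h₃ ∈ AddSubgroup.zmultiples (intPoint K 36 192 h₁) := by
      rw [← nsmul_intPoint_eq d₃]
      exact AddSubgroup.nsmul_mem_zmultiples _ _
    rcases IsCubicModel.eq_or_eq_neg hQ.1 (intPoint_ne_zero K h₃)
      (by rw [← hx, h4, abscissa_intPoint]; simp) with H | H
    · exact H ▸ hmem
    · exact H ▸ neg_mem hmem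
  refine mem_of_reduction 5 (by norm_num) (by decide +kernel) hQ5 fun s hs ↦ ⟨0, ?_⟩
  have key : ∀ r₀ r₁ : ZMod 5, IsDuplicate (-3) (-216) 1872 r₀ r₁ → r₁ = r₀ ∨ r₀ = (36 : ℤ) ∨
      r₀ = (12 : ℤ) ∨ r₀ = (-12 : ℤ) := by decide +kernel
  have hP' := nsmul_intPoint_eq_zero (K := K) hP
  rcases key _ _ (hs 0) with h | h | h | h
  · exact .inl ⟨h, h3⟩
  · exact .inr ⟨36, 192, h₁, h, AddSubgroup.mem_zmultiples _, 9, by decide, by norm_num, hP'⟩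
  · refine .inr ⟨12, 24, h₂, h, ?_, 9, by decide, by norm_num, ?_⟩
    · rw [← nsmul_intPoint_eq d₁]
      exact AddSubgroup.nsmul_mem_zmultiples _ _
    · rw [← nsmul_intPoint_eq d₁, smul_comm, hP', nsmul_zero]
  · refine .inr ⟨-12, 48, h₄, h, ?_, 9, by decide, by norm_num, ?_⟩
    · rw [← nsmul_intPoint_eq d₂, ← nsmul_intPoint_eq d₁]
      exact nsmul_mem (AddSubgroup.nsmul_mem_zmultiples _ _) _
    · rw [← nsmul_intPoint_eq d₂, ← nsmul_intPoint_eq d₁, smul_comm, smul_comm 9 2, hP',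
        nsmul_zero, nsmul_zero]

/-- The curve `y² = x (x + 2) (x + 7)`. -/
theorem isStableTorsionGroup_two_two.{u, v} {G : Type v} [AddCommGroup G]
    (e : G ≃+ ZMod 2 × ZMod (2 * 1)) : IsStableTorsionGroup.{u} G := by
  have hE : (cubicModel 9 14 0).IsElliptic := isElliptic_cubicModel (by norm_num)
  have h₁ : (0 : ℤ) ^ 2 = 0 ^ 3 + 9 * 0 ^ 2 + 14 * 0 + 0 := by norm_num
  have h₂ : (0 : ℤ) ^ 2 = (-2) ^ 3 + 9 * (-2) ^ 2 + 14 * (-2) + 0 := by norm_num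
  have h₃ : (0 : ℤ) ^ 2 = (-7) ^ 3 + 9 * (-7) ^ 2 + 14 * (-7) + 0 := by norm_num
  -- Here m = 1: the generator P is the 2-torsion point (-2, 0) itself, and T + P = (-7, 0).
  refine exists_curve_of_product.{u} one_ne_zero e (by norm_num) (by norm_num) (by norm_num)
    h₁ h₂ h₃ (by norm_num) h₂ h₃ (one_nsmul _) ?_ ?_ (by norm_num) (by norm_num) (by norm_num)
    fun K _ _ _ Q hQ ↦ ?_
  · refine addOrderOf_eq_prime (p := 2) ?_ (intPoint_ne_zero ℚ h₂)
    rw [two_nsmul, intPoint_add_self_of_eq_zero]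
  · exact intPoint_add ℚ h₁ h₂ h₃ (by norm_num) 0 (by norm_num) (by norm_num) (by norm_num)
  · obtain ⟨hQ3, -⟩ := isRatTorsion_three hQ 11 (by decide) (by decide +kernel)
    refine mem_of_reduction 3 (by norm_num) (by decide +kernel) hQ3 fun s hs ↦ ?_
    -- The roots 0, -2, -7 fill all residues modulo 3, so no residue has a duplicate.
    have key : ∀ r₀ r₁ : ZMod 3, ¬ IsDuplicate 9 14 0 r₀ r₁ := by decide +kernel
    exact absurd (hs 0) (key _ _)

/-- The curve `y² = x (x + 1) (x + 4)`. -/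
theorem isStableTorsionGroup_two_four.{u, v} {G : Type v} [AddCommGroup G]
    (e : G ≃+ ZMod 2 × ZMod (2 * 2)) : IsStableTorsionGroup.{u} G := by
  have hE : (cubicModel 5 4 0).IsElliptic := isElliptic_cubicModel (by norm_num)
  have h₁ : (0 : ℤ) ^ 2 = (-1) ^ 3 + 5 * (-1) ^ 2 + 4 * (-1) + 0 := by norm_num
  have h₂ : (0 : ℤ) ^ 2 = 0 ^ 3 + 5 * 0 ^ 2 + 4 * 0 + 0 := by norm_num
  have h₃ : (0 : ℤ) ^ 2 = (-4) ^ 3 + 5 * (-4) ^ 2 + 4 * (-4) + 0 := by norm_num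
  have h : (6 : ℤ) ^ 2 = 2 ^ 3 + 5 * 2 ^ 2 + 4 * 2 + 0 := by norm_num
  have h' : (2 : ℤ) ^ 2 = (-2) ^ 3 + 5 * (-2) ^ 2 + 4 * (-2) + 0 := by norm_num
  have d₁ : 2 • intPoint ℚ 2 6 h = intPoint ℚ 0 0 h₂ := by
    rw [two_nsmul]
    exact intPoint_add_self ℚ h h₂ (by norm_num) 3 (by norm_num) (by norm_num) (by norm_num)
  refine exists_curve_of_product.{u} two_ne_zero e (by norm_num) (by norm_num) (by norm_num)
    h₁ h₂ h₃ (by norm_num) h h' d₁ ?_ ?_ (by norm_num) (by norm_num) (by norm_num)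
    fun K _ _ _ Q hQ ↦ ?_
  · refine addOrderOf_eq_prime_pow (p := 2) (n := 1) ?_ ?_
    · rw [pow_one, d₁]
      exact intPoint_ne_zero ℚ h₂
    · rw [pow_succ, pow_one, mul_nsmul, d₁, two_nsmul, intPoint_add_self_of_eq_zero]
  · exact intPoint_add ℚ h₁ h h' (by norm_num) 2 (by norm_num) (by norm_num) (by norm_num)
  · have hV := isCubicModel_baseChange 5 4 0 K
    -- The roots -1 and -4 collide modulo 3, so reduction is modulo 5; order 5 = 2² + 1 is excluded
    -- modulo 7.
    have hQ5 : IsRatTorsion 5 Q := by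
      refine hV.isRatTorsion_of_forall (by norm_num) (hV.abscissa_notMem_range_of_nsmul 7
        (by norm_num) (by decide +kernel) (k := 2) (by norm_num) (by norm_num) (by norm_num)
        (by norm_num) fun s hs h ↦ ?_) hQ
      have key : ∀ r₀ r₁ : ZMod 7, IsDuplicate 5 4 0 r₀ r₁ → IsDuplicate 5 4 0 r₁ r₀ →
        r₁ = r₀ := by decide +kernel
      exact key _ _ (hs 0) (h ▸ hs 1)
    refine mem_of_reduction 5 (by norm_num) (by decide +kernel) hQ5 fun s hs ↦ ?_
    have key : ∀ r₀ r₁ : ZMod 5, IsDuplicate 5 4 0 r₀ r₁ → ∀ r₂, ¬ IsDuplicate 5 4 0 r₁ r₂ := by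
      decide +kernel
    exact absurd (hs 1) (key _ _ (hs 0) _)

/-- The curve `y² = (x + 20) (x - 7) (x - 12)`. -/
theorem isStableTorsionGroup_two_six.{u, v} {G : Type v} [AddCommGroup G]
    (e : G ≃+ ZMod 2 × ZMod (2 * 3)) : IsStableTorsionGroup.{u} G := by
  have hE : (cubicModel 1 (-296) 1680).IsElliptic := isElliptic_cubicModel (by norm_num)
  have h₁ : (0 : ℤ) ^ 2 = 7 ^ 3 + 1 * 7 ^ 2 + -296 * 7 + 1680 := by norm_num
  have h₂ : (0 : ℤ) ^ 2 = (-20) ^ 3 + 1 * (-20) ^ 2 + -296 * (-20) + 1680 := by norm_num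
  have h₃ : (0 : ℤ) ^ 2 = 12 ^ 3 + 1 * 12 ^ 2 + -296 * 12 + 1680 := by norm_num
  have h : (24 : ℤ) ^ 2 = 4 ^ 3 + 1 * 4 ^ 2 + -296 * 4 + 1680 := by norm_num
  have h' : (360 : ℤ) ^ 2 = 52 ^ 3 + 1 * 52 ^ 2 + -296 * 52 + 1680 := by norm_num
  have hd : (36 : ℤ) ^ 2 = 16 ^ 3 + 1 * 16 ^ 2 + -296 * 16 + 1680 := by norm_num
  have d₁ : 2 • intPoint ℚ 4 24 h = intPoint ℚ 16 36 hd := by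
    rw [two_nsmul]
    exact intPoint_add_self ℚ h hd (by norm_num) (-5) (by norm_num) (by norm_num) (by norm_num)
  have d₂ : 3 • intPoint ℚ 4 24 h = intPoint ℚ (-20) 0 h₂ := by
    rw [succ_nsmul, d₁]
    exact intPoint_add ℚ hd h h₂ (by norm_num) 1 (by norm_num) (by norm_num) (by norm_num)
  have hP : 6 • intPoint ℚ 4 24 h = 0 := by
    rw [show 6 = 3 * 2 from rfl, mul_nsmul, d₂, two_nsmul, intPoint_add_self_of_eq_zero]
  refine exists_curve_of_product.{u} three_ne_zero e (by norm_num) (by norm_num) (by norm_num)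
    h₁ h₂ h₃ (by norm_num) h h' d₂ ?_ ?_ (by norm_num) (by norm_num) (by norm_num)
    fun K _ _ _ Q hQ ↦ ?_
  · refine addOrderOf_eq_of_nsmul_and_div_prime_nsmul (by norm_num) hP fun p hp hdvd ↦ ?_
    rcases (Nat.Prime.dvd_mul hp).mp hdvd with H | H
    · rw [(Nat.prime_dvd_prime_iff_eq hp Nat.prime_two).mp H, show 2 * 3 / 2 = 3 from rfl, d₂]
      exact intPoint_ne_zero ℚ h₂
    · rw [(Nat.prime_dvd_prime_iff_eq hp Nat.prime_three).mp H, show 2 * 3 / 3 = 2 from rfl, d₁]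
      exact intPoint_ne_zero ℚ hd
  · exact intPoint_add ℚ h₁ h h' (by norm_num) (-8) (by norm_num) (by norm_num) (by norm_num)
  · have hV := isCubicModel_baseChange 1 (-296) 1680 K
    -- The root differences 27, 32, 5 rule out reduction modulo 3 and 5. Order 7 = 2³ - 1 is
    -- excluded modulo 11.
    have hQ7 : IsRatTorsion 7 Q := by
      refine hV.isRatTorsion_of_forall (by norm_num) (hV.abscissa_notMem_range_of_nsmul 11
        (by norm_num) (by decide +kernel) (k := 3) (by norm_num) (by norm_num) (by norm_num)
        (by norm_num) fun s hs h ↦ ?_) hQ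
      have key : ∀ r₀ r₁ : ZMod 11, IsDuplicate 1 (-296) 1680 r₀ r₁ → ∀ r₂,
        IsDuplicate 1 (-296) 1680 r₁ r₂ → IsDuplicate 1 (-296) 1680 r₂ r₀ → r₁ = r₀ := by
        decide +kernel
      exact key _ _ (hs 0) _ (hs 1) (h ▸ hs 2)
    refine mem_of_reduction 7 (by norm_num) (by decide +kernel) hQ7 fun s hs ↦ ?_
    -- Every double reduces to the abscissa of 2P, a point of order 3.
    have key : ∀ r₀ r₁ : ZMod 7, IsDuplicate 1 (-296) 1680 r₀ r₁ → r₁ = (16 : ℤ) := by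
      decide +kernel
    refine ⟨1, .inr ⟨16, 36, hd, key _ _ (hs 0), ?_, 3, by decide, by norm_num, ?_⟩⟩
    · rw [← nsmul_intPoint_eq d₁]
      exact AddSubgroup.nsmul_mem_zmultiples _ _
    · rw [← nsmul_intPoint_eq d₁, ← mul_nsmul]
      exact nsmul_intPoint_eq_zero hP

/-- The curve `y² = (x + 144) (x - 31) (x - 112)`. -/
theorem isStableTorsionGroup_two_eight.{u, v} {G : Type v} [AddCommGroup G]
    (e : G ≃+ ZMod 2 × ZMod (2 * 4)) : IsStableTorsionGroup.{u} G := by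
  have hE : (cubicModel 1 (-17120) 499968).IsElliptic := isElliptic_cubicModel (by norm_num)
  have h₁ : (0 : ℤ) ^ 2 = (-144) ^ 3 + 1 * (-144) ^ 2 + -17120 * (-144) + 499968 := by norm_num
  have h₂ : (0 : ℤ) ^ 2 = 112 ^ 3 + 1 * 112 ^ 2 + -17120 * 112 + 499968 := by norm_num
  have h₃ : (0 : ℤ) ^ 2 = 31 ^ 3 + 1 * 31 ^ 2 + -17120 * 31 + 499968 := by norm_num
  have h : (840 : ℤ) ^ 2 = 136 ^ 3 + 1 * 136 ^ 2 + -17120 * 136 + 499968 := by norm_num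
  have h' : (-480 : ℤ) ^ 2 = 16 ^ 3 + 1 * 16 ^ 2 + -17120 * 16 + 499968 := by norm_num
  have hd : (-3600 : ℤ) ^ 2 = 256 ^ 3 + 1 * 256 ^ 2 + -17120 * 256 + 499968 := by norm_num
  have d₁ : 2 • intPoint ℚ 136 840 h = intPoint ℚ 256 (-3600) hd := by
    rw [two_nsmul]
    exact intPoint_add_self ℚ h hd (by norm_num) 23 (by norm_num) (by norm_num) (by norm_num)
  have d₂ : 2 • intPoint ℚ 256 (-3600) hd = intPoint ℚ 112 0 h₂ := by
    rw [two_nsmul]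
    exact intPoint_add_self ℚ hd h₂ (by norm_num) (-25) (by norm_num) (by norm_num) (by norm_num)
  have d₄ : 4 • intPoint ℚ 136 840 h = intPoint ℚ 112 0 h₂ := by
    rw [show 4 = 2 * 2 from rfl, mul_nsmul, d₁, d₂]
  refine exists_curve_of_product.{u} four_ne_zero e (by norm_num) (by norm_num) (by norm_num)
    h₁ h₂ h₃ (by norm_num) h h' d₄ ?_ ?_ (by norm_num) (by norm_num) (by norm_num)
    fun K _ _ _ Q hQ ↦ ?_
  · refine addOrderOf_eq_prime_pow (p := 2) (n := 2) ?_ ?_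
    · rw [show 2 ^ 2 = 4 from rfl, d₄]
      exact intPoint_ne_zero ℚ h₂
    · rw [show 2 ^ (2 + 1) = 4 * 2 from rfl, mul_nsmul, d₄, two_nsmul,
        intPoint_add_self_of_eq_zero]
  · exact intPoint_add ℚ h₁ h h' (by norm_num) 3 (by norm_num) (by norm_num) (by norm_num)
  · have hV := isCubicModel_baseChange 1 (-17120) 499968 K
    -- The root differences 256, 175, 81 leave 11 as the least odd prime of good reduction. Order 11
    -- is excluded modulo 13, since 11 divides 2⁵ + 1.
    have hQ11 : IsRatTorsion 11 Q := by
      refine hV.isRatTorsion_of_forall (by norm_num) (hV.abscissa_notMem_range_of_nsmul 13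
        (by norm_num) (by decide +kernel) (k := 5) (by norm_num) (by norm_num) (by norm_num)
        (by norm_num) fun s hs h ↦ ?_) hQ
      have key : ∀ r₀ r₁ : ZMod 13, IsDuplicate 1 (-17120) 499968 r₀ r₁ →
        ∀ r₂, IsDuplicate 1 (-17120) 499968 r₁ r₂ → ∀ r₃, IsDuplicate 1 (-17120) 499968 r₂ r₃ →
        ∀ r₄, IsDuplicate 1 (-17120) 499968 r₃ r₄ → IsDuplicate 1 (-17120) 499968 r₄ r₀ →
        r₁ = r₀ := by decide +kernel
      exact key _ _ (hs 0) _ (hs 1) _ (hs 2) _ (hs 3) (h ▸ hs 4)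
    refine mem_of_reduction 11 (by norm_num) (by decide +kernel) hQ11 fun s hs ↦ ?_
    have key : ∀ r₀ r₁ : ZMod 11, IsDuplicate 1 (-17120) 499968 r₀ r₁ →
      ∀ r₂, IsDuplicate 1 (-17120) 499968 r₁ r₂ → ∀ r₃, ¬ IsDuplicate 1 (-17120) 499968 r₂ r₃ := by
      decide +kernel
    exact absurd (hs 2) (key _ _ (hs 0) _ (hs 1) _)

theorem proposition9 (G : Type*) [AddCommGroup G] (hG : MemPhiOne G) (hG2 : ¬ IsEvenCyclic G) :
    ∃ E : WeierstrassCurve ℚ, E.IsElliptic ∧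
      Nonempty (G ≃+ torsionPoints E ℚ) ∧
      ∀ (K : Type*) [Field K] [DecidableEq K] [NumberField K], Module.finrank ℚ K = 2 →
        (torsionPoints E ℚ).map (pointInclusion E K) = torsionPoints E K := by
  change IsStableTorsionGroup G
  rcases hG with ⟨n, hn, ⟨e⟩⟩ | ⟨m, ⟨hm1, hm4⟩, ⟨e⟩⟩
  · have hodd : Odd n := by
      rw [← Nat.not_even_iff_odd]
      rintro ⟨k, rfl⟩
      rw [← two_mul] at e
      exact hG2 ⟨k, by omega, ⟨e⟩⟩
    have hn' : n = 1 ∨ n = 3 ∨ n = 5 ∨ n = 7 ∨ n = 9 := by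
      obtain ⟨k, rfl⟩ := hodd
      omega
    rcases hn' with rfl | rfl | rfl | rfl | rfl
    · exact isStableTorsionGroup_one e
    · exact isStableTorsionGroup_three e
    · exact isStableTorsionGroup_five e
    · exact isStableTorsionGroup_seven e
    · exact isStableTorsionGroup_nine e
  · have hm : m = 1 ∨ m = 2 ∨ m = 3 ∨ m = 4 := by omega
    rcases hm with rfl | rfl | rfl | rfl
    · exact isStableTorsionGroup_two_two e
    · exact isStableTorsionGroup_two_four e
    · exact isStableTorsionGroup_two_six e
    · exact isStableTorsionGroup_two_eight e
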